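/- Let $F$ be a field, let $n\ge 0$, and let $\lambda=(\lambda_a)_{a\in\mathbb Z}$, $\mu=(\mu_a)_{a\in\mathbb Z}$ be sequences in $F$ (only the terms with $|a|\le n-2$ matter). For a sequence $f$ write $(s^{\pm1}f)_a=f_{a\pm1}$, and let $A_{i_1,\dots,i_k}^{j_1,\dots,j_k}$ denote $A$ with rows $i_1,\dots,i_k$ and columns $j_1,\dots,j_k$ erased. The generalized Lambda-determinant $|A|_{\lambda,\mu}$ of an $n\times n$ matrix $A=(a_{i,j})$ is defined recursively: it is $1$ for $n=0$, it is $a$ for the $1\times1$ matrix $(a)$, and for $n\ge2$ $$|A|_{\lambda,\mu}=\frac{\mu_0\,|A_1^1|_{\lambda,s\mu}\,|A_n^n|_{\lambda,s^{-1}\mu}+\lambda_0\,|A_1^n|_{s^{-1}\lambda,\mu}\,|A_n^1|_{s\lambda,\mu}}{|A_{1,n}^{1,n}|_{\lambda,\mu}} .$$ Equivalently, $|A|_{\lambda,\mu}=T_{0,0,n}$ for the solution of $T_{i,j,k+1}T_{i,j,k-1}=\mu_jT_{i,j+1,k}T_{i,j-1,k}+\lambda_iT_{i+1,j,k}T_{i-1,j,k}$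 with $T_{i,j,0}=1$ and $T_{i,j,1}=a_{(j-i+n+1)/2,\,(i+j+n+1)/2}$. The definition makes sense if none of the denominators met in the recursion vanishes. An alternating sign matrix (ASM) is a square matrix $B=(b_{i,j})$ with entries in $\{0,1,-1\}$, in each row and column of which the entries sum to $1$ and the nonzero entries alternate in sign. An $n\times n$ ASM $B$ corresponds to exactly one six-vertex configuration on the $n\times n$ grid with domain wall boundary conditions, that is, an orientation of the edges such that every vertex has two incoming and two outgoing edges, the external horizontal edges point towards the grid and the external vertical edges point out of it; the correspondence is that $b_{i,j}=1$ at the vertices of type $c_1$, $b_{i,j}=-1$ at those of type $c_2$, and $b_{i,j}=0$ at all others. The type $\mathcal C(B)_{i,j}$ of the vertex in row $i$ (counted from the top) and column $j$ is: $a_1$ if its horizontal edges point right and its vertical ones up; $a_2$ if left and down; $b_1$ if right and down; $b_2$ if left and up; $c_1$ if its horizontal edges point in and its vertical ones out; $c_2$ if its horizontal edges point out and its vertical ones in. Whenever the definition of $|A|_{\lambda,\mu}$ makes sense, $$|A|_{\lambda,\mu}=\sum_{B\ n\times n\ \mathrm{ASM}}\ \prod_{i,j=1}^n w_{i,j}(A,B;\lambda,\mu),\qquad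 w_{i,j}(A,B;\lambda,\mu)=(a_{i,j})^{b_{i,j}}\times\begin{cases}\lambda_{j-i}&\text{if }\mathcal C(B)_{i,j}=a_1,\\ \mu_{i+j-n-1}&\text{if }\mathcal C(B)_{i,j}=b_1,\\ \lambda_{j-i}+\mu_{i+j-n-1}&\text{if }\mathcal C(B)_{i,j}=c_2,\\ 1&\text{otherwise.}\end{cases}$$ Moreover, if $\lambda_a\ne0$ and $\mu_a\ne0$ for all $|a|\le n-2$, then the definition makes sense for the matrix of independent indeterminates over the field $F(a_{i,j}:1\le i,j\le n)$, so that the formula holds as an identity of rational functions in the $a_{i,j}$. -/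

import Mathlib

namespace LambdaDet

/-! ### The generalized Lambda-determinant -/

/-- The `k`-th power `s ^ k` of the shift operator on sequences: `(s ^ k f)_a = f_{a + k}`. -/
def shift {F : Type*} (k : ℤ) (f : ℤ → F) : ℤ → F := fun a => f (a + k)

section Minors

variable {F : Type*} {n : ℕ}

/-- `A` with its first row and first column erased. -/
def minorFF (A : Matrix (Fin (n + 1)) (Fin (n + 1)) F) : Matrix (Fin n) (Fin n) F :=
  A.submatrix Fin.succ Fin.succ

/-- `A` with its last row and last column erased. -/
def minorLL (A : Matrix (Fin (n + 1)) (Fin (n + 1)) F) : Matrix (Fin n) (Fin n) F :=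
  A.submatrix Fin.castSucc Fin.castSucc

/-- `A` with its first row and last column erased. -/
def minorFL (A : Matrix (Fin (n + 1)) (Fin (n + 1)) F) : Matrix (Fin n) (Fin n) F :=
  A.submatrix Fin.succ Fin.castSucc

/-- `A` with its last row and first column erased. -/
def minorLF (A : Matrix (Fin (n + 1)) (Fin (n + 1)) F) : Matrix (Fin n) (Fin n) F :=
  A.submatrix Fin.castSucc Fin.succ

/-- `A` with its first and last rows and its first and last columns erased. -/
def interior (A : Matrix (Fin (n + 2)) (Fin (n + 2)) F) : Matrix (Fin n) (Fin n) F :=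
  A.submatrix (fun i => i.castSucc.succ) (fun j => j.castSucc.succ)

end Minors

/-- The generalized Lambda-determinant, computed by the modified Dodgson condensation. This is the
solution `T_{0,0,n}` of the inhomogeneous `T`-system
`T_{i,j,k+1} T_{i,j,k-1} = μ_j T_{i,j+1,k} T_{i,j-1,k} + λ_i T_{i+1,j,k} T_{i-1,j,k}` with
`T_{i,j,0} = 1` and `T_{i,j,1} = a_{(j-i+n+1)/2,(i+j+n+1)/2}`: here `T_{i,j,k}` belongs to the
contiguous `k × k` submatrix centred at row `(j-i+n+1)/2` and column `(i+j+n+1)/2`, with the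
sequence `λ` shifted by `i` and the sequence `μ` shifted by `j`. Hence erasing the first (last) row
and column shifts only `μ`, and erasing opposite ones shifts only `λ`.
It is meaningful only when no division by zero occurs, see `Condensable`. -/
def lambdaDet {F : Type*} [Field F] :
    (n : ℕ) → Matrix (Fin n) (Fin n) F → (ℤ → F) → (ℤ → F) → F
  | 0, _, _, _ => 1
  | 1, A, _, _ => A 0 0
  | n + 2, A, lam, mu =>
      (mu 0 * lambdaDet (n + 1) (minorFF A) lam (shift 1 mu)
            * lambdaDet (n + 1) (minorLL A) lam (shift (-1) mu)
        + lam 0 * lambdaDet (n + 1) (minorFL A) (shift (-1) lam) mu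
            * lambdaDet (n + 1) (minorLF A) (shift 1 lam) mu)
      / lambdaDet n (interior A) lam mu

/-- The recursive definition of the generalized Lambda-determinant makes sense: no denominator
met in the course of the recursion vanishes. -/
def Condensable {F : Type*} [Field F] :
    (n : ℕ) → Matrix (Fin n) (Fin n) F → (ℤ → F) → (ℤ → F) → Prop
  | 0, _, _, _ => True
  | 1, _, _, _ => True
  | n + 2, A, lam, mu =>
      Condensable (n + 1) (minorFF A) lam (shift 1 mu) ∧
      Condensable (n + 1) (minorLL A) lam (shift (-1) mu) ∧
      Condensable (n + 1) (minorFL A) (shift (-1) lam) mu ∧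
      Condensable (n + 1) (minorLF A) (shift 1 lam) mu ∧
      Condensable n (interior A) lam mu ∧
      lambdaDet n (interior A) lam mu ≠ 0

/-! ### Alternating sign matrices -/

/-- The sum of the first `k` entries of row `i`. -/
def rowSum {n : ℕ} (B : Matrix (Fin n) (Fin n) ℤ) (i : Fin n) (k : ℕ) : ℤ :=
  ∑ j : Fin n, if (j : ℕ) < k then B i j else 0

/-- The sum of the first `k` entries of column `j`. -/
def colSum {n : ℕ} (B : Matrix (Fin n) (Fin n) ℤ) (k : ℕ) (j : Fin n) : ℤ :=
  ∑ i : Fin n, if (i : ℕ) < k then B i j else 0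

/-- Alternating sign matrices: the entries are `0`, `1`, `-1`, the rows and columns sum to `1`, and
the partial sums of each row and column are `0` or `1` (that is, the nonzero entries of each row
and column alternate in sign, starting and ending with `1`). -/
structure IsASM {n : ℕ} (B : Matrix (Fin n) (Fin n) ℤ) : Prop where
  entry : ∀ i j, B i j = -1 ∨ B i j = 0 ∨ B i j = 1
  row_partial : ∀ i, ∀ k ≤ n, rowSum B i k = 0 ∨ rowSum B i k = 1
  col_partial : ∀ j, ∀ k ≤ n, colSum B k j = 0 ∨ colSum B k j = 1
  row_total : ∀ i, ∑ j, B i j = 1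
  col_total : ∀ j, ∑ i, B i j = 1

/-- The type of `n × n` alternating sign matrices. -/
def ASM (n : ℕ) : Type := {B : Matrix (Fin n) (Fin n) ℤ // IsASM B}

instance (n : ℕ) : Finite (ASM n) := by
  have h : Set.Finite {B : Fin n → Fin n → ℤ | ∀ i, B i ∈ {v : Fin n → ℤ |
      ∀ j, v j ∈ ({-1, 0, 1} : Set ℤ)}} :=
    Set.Finite.pi' fun _ => Set.Finite.pi' fun _ => Set.toFinite _
  exact Set.Finite.subset (s := {B : Fin n → Fin n → ℤ | ∀ i, B i ∈ {v : Fin n → ℤ |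
      ∀ j, v j ∈ ({-1, 0, 1} : Set ℤ)}}) h
    (t := {B : Fin n → Fin n → ℤ | IsASM (n := n) B}) fun B hB i j => hB.entry i j

noncomputable instance (n : ℕ) : Fintype (ASM n) := Fintype.ofFinite _

/-! ### The six-vertex model with domain wall boundary conditions -/

/-- A six-vertex configuration with domain wall boundary conditions on the `n × n` grid, whose
vertices `(i, j)` are indexed as matrix positions (`i` grows downwards, `j` to the right).
The edges of vertex `(i, j)` are: west `right i j`, east `right i (j + 1)`, north `up i j`,
south `up (i + 1) j`. -/
@[ext]
structure SixVertexDWBC (n : ℕ) where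
  /-- whether the `k`-th horizontal edge of row `i` points to the right -/
  right : Fin n → Fin (n + 1) → Bool
  /-- whether the `k`-th vertical edge of column `j` points up -/
  up : Fin (n + 1) → Fin n → Bool
  /-- each vertex has two incoming (hence two outgoing) edges -/
  ice : ∀ i j, (right i j.castSucc).toNat + (!right i j.succ).toNat
    + (!up i.castSucc j).toNat + (up i.succ j).toNat = 2
  /-- external horizontal edges point towards the grid -/
  west : ∀ i, right i 0 = true
  east : ∀ i, right i (Fin.last n) = false
  /-- external vertical edges point out of the grid -/
  north : ∀ j, up 0 j = true
  south : ∀ j, up (Fin.last n) j = false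

/-- The six local configurations. With the directions in which the arrows run:
`a₁` right and up, `a₂` left and down, `b₁` right and down, `b₂` left and up;
`c₁`: horizontal edges in, vertical edges out; `c₂`: horizontal edges out, vertical edges in. -/
inductive VertexType
  | a₁ | a₂ | b₁ | b₂ | c₁ | c₂

/-- The configuration of the vertex `(i, j)`. The west, east and north edges suffice, since
by the ice rule they determine the south edge. -/
def SixVertexDWBC.vertex {n : ℕ} (C : SixVertexDWBC n) (i j : Fin n) : VertexType :=
  match C.right i j.castSucc, C.right i j.succ, C.up i.castSucc j with
  | true, true, true => .a₁
  | false, false, false => .a₂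
  | true, true, false => .b₁
  | false, false, true => .b₂
  | true, false, _ => .c₁
  | false, true, _ => .c₂

/-- The matrix entry that corresponds to a local configuration. -/
def VertexType.entry : VertexType → ℤ
  | .c₁ => 1
  | .c₂ => -1
  | _ => 0

theorem rowSum_succ {n : ℕ} (B : Matrix (Fin n) (Fin n) ℤ) (i j : Fin n) :
    rowSum B i (j + 1) = rowSum B i j + B i j := by
  have h : B i j = ∑ k : Fin n, if k = j then B i k else 0 := by simp
  rw [rowSum, rowSum, h, ← Finset.sum_add_distrib]
  refine Finset.sum_congr rfl fun k _ => ?_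
  rcases lt_trichotomy k j with hk | hk | hk
  · simp [hk.ne, Fin.lt_def.1 hk, (Fin.lt_def.1 hk).trans (Nat.lt_succ_self _)]
  · simp [hk]
  · have := Fin.lt_def.1 hk
    simp [hk.ne', show ¬ (k : ℕ) < j + 1 by omega, show ¬ (k : ℕ) < j by omega]

theorem colSum_succ {n : ℕ} (B : Matrix (Fin n) (Fin n) ℤ) (i j : Fin n) :
    colSum B (i + 1) j = colSum B i j + B i j :=
  rowSum_succ B.transpose j i

theorem IsASM.rowSum_last {n : ℕ} {B : Matrix (Fin n) (Fin n) ℤ} (hB : IsASM B) (i : Fin n) :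
    rowSum B i n = 1 := by
  simpa [rowSum] using hB.row_total i

theorem IsASM.colSum_last {n : ℕ} {B : Matrix (Fin n) (Fin n) ℤ} (hB : IsASM B) (j : Fin n) :
    colSum B n j = 1 := by
  simpa [colSum] using hB.col_total j

/-- The six-vertex configuration `C(B)` of an alternating sign matrix `B`: a horizontal edge points
right if and only if the entries of `B` to its left sum to `0`, a vertical edge points up if and
only if the entries of `B` above it sum to `0`. By `config_unique` below, it is the only
configuration whose `c₁` vertices are the entries `1` of `B` and whose `c₂` vertices are the
entries `-1` of `B`. -/
def ASM.config {n : ℕ} (B : ASM n) : SixVertexDWBC n where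
  right i k := decide (rowSum B.1 i k = 0)
  up k j := decide (colSum B.1 k j = 0)
  ice i j := by
    have h1 := B.2.row_partial i j j.2.le
    have h2 := B.2.row_partial i (j + 1) j.2
    have h3 := B.2.col_partial j i i.2.le
    have h4 := B.2.col_partial j (i + 1) i.2
    have h5 := rowSum_succ B.1 i j
    have h6 := colSum_succ B.1 i j
    simp only [Fin.val_castSucc, Fin.val_succ]
    rcases h1 with h1 | h1 <;> rcases h2 with h2 | h2 <;> rcases h3 with h3 | h3 <;>
      rcases h4 with h4 | h4 <;> simp [h1, h2, h3, h4] <;> omega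
  west i := by simp [rowSum]
  east i := by simp [B.2.rowSum_last]
  north j := by simp [colSum]
  south j := by simp [B.2.colSum_last]

theorem ASM.entry_config {n : ℕ} (B : ASM n) (i j : Fin n) :
    (B.config.vertex i j).entry = B.1 i j := by
  have h1 := B.2.row_partial i j j.2.le
  have h2 := B.2.row_partial i (j + 1) j.2
  have h3 := B.2.col_partial j i i.2.le
  have h5 := rowSum_succ B.1 i j
  rcases h1 with h1 | h1 <;> rcases h2 with h2 | h2 <;> rcases h3 with h3 | h3 <;>
    simp [SixVertexDWBC.vertex, ASM.config, VertexType.entry, h1, h2, h3] <;> omega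

theorem ASM.config_unique {n : ℕ} (B : ASM n) (C : SixVertexDWBC n)
    (hC : ∀ i j, (C.vertex i j).entry = B.1 i j) : C = B.config := by
  have key : ∀ D : SixVertexDWBC n, ∀ i j,
      (D.vertex i j).entry = (D.right i j.castSucc).toNat - (D.right i j.succ).toNat ∧
      (D.vertex i j).entry = (D.up i.castSucc j).toNat - (D.up i.succ j).toNat := by
    intro D i j
    have h := D.ice i j
    revert h
    unfold SixVertexDWBC.vertex
    cases D.right i j.castSucc <;> cases D.right i j.succ <;> cases D.up i.castSucc j <;>
      cases D.up i.succ j <;> simp [VertexType.entry]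
  have inj : ∀ a b : Bool, a.toNat = b.toNat → a = b := by decide
  have hr : ∀ i k, C.right i k = B.config.right i k := by
    intro i k
    induction k using Fin.induction with
    | zero => rw [C.west, B.config.west]
    | succ j ih =>
      have h1 := (key C i j).1
      have h2 := (key B.config i j).1
      rw [hC, ih] at h1
      rw [B.entry_config] at h2
      exact inj _ _ (by omega)
  have hu : ∀ k j, C.up k j = B.config.up k j := by
    intro k j
    induction k using Fin.induction with
    | zero => rw [C.north, B.config.north]
    | succ i ih =>
      have h1 := (key C i j).2
      have h2 := (key B.config i j).2
      rw [hC, ih] at h1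
      rw [B.entry_config] at h2
      exact inj _ _ (by omega)
  ext i k
  · rw [hr]
  · rw [hu]

/-! ### The local weights -/

/-- The local weight at position `(i, j)`. Here `i` and `j` run from `0` to `n - 1`, so that the
index `i + j - n - 1` for positions counted from `1` becomes `i + j + 1 - n`. -/
def weight {F : Type*} [Field F] {n : ℕ} (A : Matrix (Fin n) (Fin n) F) (B : ASM n)
    (lam mu : ℤ → F) (i j : Fin n) : F :=
  A i j ^ B.1 i j *
    match B.config.vertex i j with
    | .a₁ => lam ((j : ℤ) - i)
    | .b₁ => mu ((i : ℤ) + j + 1 - n)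
    | .c₂ => lam ((j : ℤ) - i) + mu ((i : ℤ) + j + 1 - n)
    | _ => 1

/-! ### The generic matrix -/

/-- The field of rational functions over `F` in `n ^ 2` indeterminates. -/
abbrev GenericField (F : Type*) [Field F] (n : ℕ) : Type _ :=
  FractionRing (MvPolynomial (Fin n × Fin n) F)

/-- The `n × n` matrix whose entries are the indeterminates. -/
noncomputable def genericMatrix (F : Type*) [Field F] (n : ℕ) :
    Matrix (Fin n) (Fin n) (GenericField F n) :=
  (Matrix.mvPolynomialX (Fin n) (Fin n) F).map (algebraMap _ (GenericField F n))

/-- A sequence of parameters in `F`, viewed in the field of rational functions. -/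
noncomputable def constParam {F : Type*} [Field F] (n : ℕ) (f : ℤ → F) : ℤ → GenericField F n :=
  fun a => algebraMap F (GenericField F n) (f a)

end LambdaDet

/-!
The recursion is Dodgson condensation, so the entries of its tables are determinants of connected
minors. Following Robbins and Rumsey, consider the generating function of pairs of compatible
(interlacing) alternating sign matrices of consecutive orders `m + 1` and `m`, in which the larger
matrix carries the minors of one order and the smaller one, with inverted entries, those of the
order below. Summing over the smaller matrix first makes the sum a product of local sums, and so
does summing over the larger one first: in terms of corner sums, compatibility only confines each
value to an interval determined by the other matrix. Summation by parts brings the two products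
into the same shape, and a local identity with six cases, one for each vertex type, shows that one
step of the condensation lowers `m` by one without changing the generating function. For `m = 0` it
is the Lambda-determinant. For the largest `m`, where the smaller matrix carries only ones, the sum
over the smaller matrix turns into the product of the six-vertex weights.

Summation by parts divides by all minors, while the recursion only divides by interior ones. A
deformation over the power series in one variable `t` therefore makes all of them nonzero, and
setting `t = 0` afterwards is harmless.

For a matrix of indeterminates, distinct alternating sign matrices contribute distinct monomials,
and the identity matrix contributes a product of values of `mu`. By the expansion itself, applied
to smaller matrices, no denominator of the recursion vanishes.
-/

namespace LambdaDet

/-! ### Corner sums -/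

section CornerSum

open Finset

variable {M : Type*} [AddCommGroup M]

/-- The mixed second difference of a function on the quadrant: the operation inverse to
`cornerSum`. -/
def mixedDiff (H : ℕ → ℕ → M) (i j : ℕ) : M :=
  H (i + 1) (j + 1) + H i j - H (i + 1) j - H i (j + 1)

/-- The corner sums `∑ a p q` over `p < i` and `q < j` of an infinite matrix. -/
def cornerSum (a : ℕ → ℕ → M) (i j : ℕ) : M :=
  ∑ p ∈ range i, ∑ q ∈ range j, a p q

theorem cornerSum_swap (a : ℕ → ℕ → M) (i j : ℕ) :
    cornerSum (Function.swap a) i j = cornerSum a j i :=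
  sum_comm

theorem cornerSum_succ_left (a : ℕ → ℕ → M) (i j : ℕ) :
    cornerSum a (i + 1) j = cornerSum a i j + ∑ q ∈ range j, a i q :=
  sum_range_succ _ _

theorem mixedDiff_cornerSum (a : ℕ → ℕ → M) : mixedDiff (cornerSum a) = a := by
  ext i j
  simp only [mixedDiff, cornerSum_succ_left, sum_range_succ]
  abel

theorem cornerSum_mixedDiff {H : ℕ → ℕ → M} (htop : ∀ j, H 0 j = 0) (hleft : ∀ i, H i 0 = 0) :
    cornerSum (mixedDiff H) = H := by
  ext i j
  have hrow (p : ℕ) : ∑ q ∈ range j, mixedDiff H p q = H (p + 1) j - H p j := by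
    have h := sum_range_sub (fun q => H (p + 1) q - H p q) j
    rw [hleft, hleft, sub_self, sub_zero] at h
    rw [← h]
    exact sum_congr rfl fun q _ => by rw [mixedDiff]; abel
  rw [cornerSum, sum_congr rfl fun p _ => hrow p, sum_range_sub (H · j), htop, sub_zero]

theorem mixedDiff_swap (H : ℕ → ℕ → M) (i j : ℕ) :
    mixedDiff (Function.swap H) i j = mixedDiff H j i := by
  simp only [mixedDiff, Function.swap]
  abel

theorem mixedDiff_sub (H K : ℕ → ℕ → M) : mixedDiff (H - K) = mixedDiff H - mixedDiff K := by
  ext i j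
  simp only [mixedDiff, Pi.sub_apply]
  abel

end CornerSum

section Extend

variable {R : Type*} [Zero R] {n : ℕ}

/-- The continuation of a square matrix by zeros to the quadrant. -/
def extend (A : Matrix (Fin n) (Fin n) R) (i j : ℕ) : R :=
  if h : i < n ∧ j < n then A ⟨i, h.1⟩ ⟨j, h.2⟩ else 0

@[simp]
theorem extend_val (A : Matrix (Fin n) (Fin n) R) (i j : Fin n) : extend A i j = A i j := by
  simp [extend]

theorem extend_of_lt (A : Matrix (Fin n) (Fin n) R) {i j : ℕ} (hi : i < n) (hj : j < n) :
    extend A i j = A ⟨i, hi⟩ ⟨j, hj⟩ :=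
  dif_pos ⟨hi, hj⟩

theorem extend_of_le_left (A : Matrix (Fin n) (Fin n) R) {i : ℕ} (hi : n ≤ i) (j : ℕ) :
    extend A i j = 0 :=
  dif_neg fun h => hi.not_gt h.1

theorem extend_of_le_right (A : Matrix (Fin n) (Fin n) R) (i : ℕ) {j : ℕ} (hj : n ≤ j) :
    extend A i j = 0 :=
  dif_neg fun h => hj.not_gt h.2

theorem extend_transpose (A : Matrix (Fin n) (Fin n) R) :
    extend A.transpose = Function.swap (extend A) := by
  ext i j
  simp only [extend, Function.swap, Matrix.transpose_apply, and_comm]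

end Extend

/-! ### Height functions -/

/-- The boundary values common to all corner sums of `n × n` alternating sign matrices. -/
def HasHeightBoundary (n : ℕ) (H : ℕ → ℕ → ℤ) : Prop :=
  ∀ i j, i = 0 ∨ n ≤ i ∨ j = 0 ∨ n ≤ j → H i j = min (min (i : ℤ) j) n

/-- Height functions of order `n`: the corner sums of `n × n` alternating sign matrices, where the
matrices are continued by zeros to the quadrant. -/
structure IsHeight (n : ℕ) (H : ℕ → ℕ → ℤ) : Prop where
  boundary : HasHeightBoundary n H
  down : ∀ i j, H (i + 1) j = H i j ∨ H (i + 1) j = H i j + 1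
  across : ∀ i j, H i (j + 1) = H i j ∨ H i (j + 1) = H i j + 1

/-- The type of height functions of order `n`. -/
abbrev Height (n : ℕ) : Type := {H : ℕ → ℕ → ℤ // IsHeight n H}

namespace HasHeightBoundary

variable {n : ℕ} {H : ℕ → ℕ → ℤ}

theorem top (hH : HasHeightBoundary n H) (j : ℕ) : H 0 j = 0 := by
  rw [hH 0 j (.inl rfl)]
  omega

theorem left (hH : HasHeightBoundary n H) (i : ℕ) : H i 0 = 0 := by
  rw [hH i 0 (.inr (.inr (.inl rfl)))]
  omega

theorem bottom (hH : HasHeightBoundary n H) {i : ℕ} (hi : n ≤ i) (j : ℕ) :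
    H i j = min (j : ℤ) n := by
  rw [hH i j (.inr (.inl hi))]
  omega

theorem right (hH : HasHeightBoundary n H) (i : ℕ) {j : ℕ} (hj : n ≤ j) :
    H i j = min (i : ℤ) n := by
  rw [hH i j (.inr (.inr (.inr hj)))]
  omega

theorem swap (hH : HasHeightBoundary n H) : HasHeightBoundary n (Function.swap H) := by
  intro i j hij
  rw [Function.swap, hH j i (by tauto), min_comm (j : ℤ)]

theorem mixedDiff_of_le_left (hH : HasHeightBoundary n H) {i : ℕ} (hi : n ≤ i) (j : ℕ) :
    mixedDiff H i j = 0 := by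
  simp only [mixedDiff, hH.bottom hi, hH.bottom (Nat.le_succ_of_le hi)]
  ring

theorem mixedDiff_of_le_right (hH : HasHeightBoundary n H) (i : ℕ) {j : ℕ} (hj : n ≤ j) :
    mixedDiff H i j = 0 := by
  rw [← mixedDiff_swap, hH.swap.mixedDiff_of_le_left hj]

end HasHeightBoundary

namespace IsHeight

variable {n : ℕ} {H : ℕ → ℕ → ℤ}

theorem swap (hH : IsHeight n H) : IsHeight n (Function.swap H) :=
  ⟨hH.boundary.swap, fun i j => hH.across j i, fun i j => hH.down j i⟩

theorem mixedDiff_mem (hH : IsHeight n H) (i j : ℕ) :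
    mixedDiff H i j = -1 ∨ mixedDiff H i j = 0 ∨ mixedDiff H i j = 1 := by
  have h := hH.down i j
  have h' := hH.down i (j + 1)
  rw [mixedDiff]
  omega

theorem row_interior_of_mixedDiff_eq_neg_one (hH : IsHeight n H) {i j : ℕ}
    (h : mixedDiff H i j = -1) : 0 < i ∧ i + 1 < n := by
  constructor
  · by_contra! hi
    obtain rfl : i = 0 := by omega
    have hstep := hH.across 1 j
    simp only [mixedDiff, hH.boundary.top, zero_add] at h
    omega
  · by_contra! hi
    have hj : j < n := by
      by_contra! hj
      rw [hH.boundary.mixedDiff_of_le_right i hj] at h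
      omega
    have hstep := hH.across i j
    simp only [mixedDiff, hH.boundary.bottom hi] at h
    push_cast at h
    omega

theorem col_interior_of_mixedDiff_eq_neg_one (hH : IsHeight n H) {i j : ℕ}
    (h : mixedDiff H i j = -1) : 0 < j ∧ j + 1 < n :=
  hH.swap.row_interior_of_mixedDiff_eq_neg_one (by rw [mixedDiff_swap, h])

end IsHeight

theorem isHeight_min (n : ℕ) : IsHeight n fun i j => min (min (i : ℤ) j) n := by
  refine ⟨fun i j _ => rfl, fun i j => ?_, fun i j => ?_⟩ <;> push_cast <;> omega

theorem HasHeightBoundary.eq_min_of_le_one {n : ℕ} {H : ℕ → ℕ → ℤ} (hH : HasHeightBoundary n H)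
    (hn : n ≤ 1) : H = fun i j : ℕ => min (min (i : ℤ) j) n := by
  ext i j
  exact hH i j (by omega)

/-- There is only one alternating sign matrix of order at most `1`. -/
abbrev uniqueHeight {n : ℕ} (hn : n ≤ 1) : Unique (Height n) where
  default := ⟨_, isHeight_min n⟩
  uniq H := Subtype.ext (H.2.boundary.eq_min_of_le_one hn)

/-! ### Height functions and alternating sign matrices -/

theorem sum_range_extend {n : ℕ} (B : Matrix (Fin n) (Fin n) ℤ) (i : Fin n) (k : ℕ) :
    ∑ q ∈ Finset.range k, extend B i q = rowSum B i (min k n) := by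
  induction k with
  | zero => simp [rowSum]
  | succ k ih =>
    rw [Finset.sum_range_succ, ih]
    rcases lt_or_ge k n with hk | hk
    · rw [min_eq_left hk.le, min_eq_left (Nat.succ_le_of_lt hk), rowSum_succ B i ⟨k, hk⟩,
        extend_of_lt B i.2 hk]
    · rw [min_eq_right hk, min_eq_right (Nat.le_succ_of_le hk), extend_of_le_right B i hk, add_zero]

theorem cornerSum_extend_transpose {M : Type*} [AddCommGroup M] {n : ℕ}
    (A : Matrix (Fin n) (Fin n) M) (i j : ℕ) :
    cornerSum (extend A.transpose) i j = cornerSum (extend A) j i := by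
  rw [extend_transpose, cornerSum_swap]

namespace IsASM

variable {n : ℕ} {B : Matrix (Fin n) (Fin n) ℤ}

theorem transpose (hB : IsASM B) : IsASM B.transpose :=
  ⟨fun i j => hB.entry j i, hB.col_partial, hB.row_partial, hB.col_total, hB.row_total⟩

theorem cornerSum_down (hB : IsASM B) (i j : ℕ) :
    cornerSum (extend B) (i + 1) j = cornerSum (extend B) i j ∨
      cornerSum (extend B) (i + 1) j = cornerSum (extend B) i j + 1 := by
  rw [cornerSum_succ_left]
  rcases lt_or_ge i n with hi | hi
  · rw [sum_range_extend B ⟨i, hi⟩]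
    have h := hB.row_partial ⟨i, hi⟩ (min j n) (min_le_right _ _)
    omega
  · exact .inl (by simp [extend_of_le_left B hi])

theorem cornerSum_right (hB : IsASM B) (i : ℕ) {j : ℕ} (hj : n ≤ j) :
    cornerSum (extend B) i j = min (i : ℤ) n := by
  induction i with
  | zero => simp [cornerSum]
  | succ i ih =>
    rw [cornerSum_succ_left, ih]
    rcases lt_or_ge i n with hi | hi
    · rw [sum_range_extend B ⟨i, hi⟩, min_eq_right hj, hB.rowSum_last]
      omega
    · rw [Finset.sum_eq_zero fun q _ => extend_of_le_left B hi q]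
      omega

theorem isHeight_cornerSum (hB : IsASM B) : IsHeight n (cornerSum (extend B)) where
  boundary i j hij := by
    rcases hij with rfl | hi | rfl | hj
    · simp [cornerSum]
    · rw [← cornerSum_extend_transpose, hB.transpose.cornerSum_right j hi]
      omega
    · simp [cornerSum]
    · rw [hB.cornerSum_right i hj]
      omega
  down := hB.cornerSum_down
  across i j := by simpa only [cornerSum_extend_transpose] using hB.transpose.cornerSum_down j i

end IsASM

/-- The `n × n` matrix of mixed differences of a function on the quadrant: the alternating sign
matrix of a height function. -/
def diffMatrix (n : ℕ) (H : ℕ → ℕ → ℤ) : Matrix (Fin n) (Fin n) ℤ :=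
  Matrix.of fun i j => mixedDiff H i j

theorem diffMatrix_swap (n : ℕ) (H : ℕ → ℕ → ℤ) :
    diffMatrix n (Function.swap H) = (diffMatrix n H).transpose := by
  ext i j
  exact mixedDiff_swap H i j

theorem HasHeightBoundary.extend_diffMatrix {n : ℕ} {H : ℕ → ℕ → ℤ} (hH : HasHeightBoundary n H) :
    extend (diffMatrix n H) = mixedDiff H := by
  ext i j
  rcases lt_or_ge i n with hi | hi
  · rcases lt_or_ge j n with hj | hj
    · rw [extend_of_lt _ hi hj, diffMatrix, Matrix.of_apply]
    · rw [extend_of_le_right _ i hj, hH.mixedDiff_of_le_right i hj]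
  · rw [extend_of_le_left _ hi, hH.mixedDiff_of_le_left hi]

theorem HasHeightBoundary.cornerSum_diffMatrix {n : ℕ} {H : ℕ → ℕ → ℤ}
    (hH : HasHeightBoundary n H) : cornerSum (extend (diffMatrix n H)) = H := by
  rw [hH.extend_diffMatrix, cornerSum_mixedDiff hH.top hH.left]

theorem HasHeightBoundary.rowSum_diffMatrix {n : ℕ} {H : ℕ → ℕ → ℤ} (hH : HasHeightBoundary n H)
    (i : Fin n) {k : ℕ} (hk : k ≤ n) : rowSum (diffMatrix n H) i k = H (i + 1) k - H i k := by
  have h := cornerSum_succ_left (extend (diffMatrix n H)) i k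
  rw [hH.cornerSum_diffMatrix, sum_range_extend, min_eq_left hk] at h
  rw [h, add_sub_cancel_left]

theorem HasHeightBoundary.colSum_diffMatrix {n : ℕ} {H : ℕ → ℕ → ℤ} (hH : HasHeightBoundary n H)
    (j : Fin n) {k : ℕ} (hk : k ≤ n) : colSum (diffMatrix n H) k j = H k (j + 1) - H k j := by
  have h := hH.swap.rowSum_diffMatrix j hk
  rwa [diffMatrix_swap] at h

theorem IsHeight.isASM_diffMatrix {n : ℕ} {H : ℕ → ℕ → ℤ} (hH : IsHeight n H) :
    IsASM (diffMatrix n H) where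
  entry := fun i j => hH.mixedDiff_mem i j
  row_partial i k hk := by
    rw [hH.boundary.rowSum_diffMatrix i hk]
    have h := hH.down i k
    omega
  col_partial j k hk := by
    rw [hH.boundary.colSum_diffMatrix j hk]
    have h := hH.across k j
    omega
  row_total i := by
    have h := hH.boundary.rowSum_diffMatrix i le_rfl
    rw [hH.boundary.right _ le_rfl, hH.boundary.right _ le_rfl] at h
    simp only [rowSum, Fin.is_lt, if_true] at h
    omega
  col_total j := by
    have h := hH.boundary.colSum_diffMatrix j le_rfl
    rw [hH.boundary.bottom le_rfl, hH.boundary.bottom le_rfl] at h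
    simp only [colSum, Fin.is_lt, if_true] at h
    omega

/-- The bijection between height functions and alternating sign matrices, given by mixed
differences and corner sums. -/
def heightEquiv (n : ℕ) : Height n ≃ ASM n where
  toFun H := ⟨diffMatrix n H.1, H.2.isASM_diffMatrix⟩
  invFun B := ⟨cornerSum (extend B.1), B.2.isHeight_cornerSum⟩
  left_inv H := Subtype.ext H.2.boundary.cornerSum_diffMatrix
  right_inv B := Subtype.ext <| by
    ext i j
    simp [diffMatrix, mixedDiff_cornerSum]

noncomputable instance (n : ℕ) : Fintype (Height n) := Fintype.ofEquiv _ (heightEquiv n).symm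

/-! ### Compatible pairs -/

/-- The values which a height function of order `m` compatible with `H` may take at `(i, j)`. -/
noncomputable def lowerRange (H : ℕ → ℕ → ℤ) (i j : ℕ) : Finset ℤ :=
  Finset.Icc (max (H i j) (H (i + 1) (j + 1) - 1)) (min (H (i + 1) j) (H i (j + 1)))

/-- The values which a height function of order `m + 1` compatible with `K` may take at
`(i + 1, j + 1)`. -/
noncomputable def upperRange (K : ℕ → ℕ → ℤ) (i j : ℕ) : Finset ℤ :=
  Finset.Icc (max (K i (j + 1)) (K (i + 1) j)) (min (K i j + 1) (K (i + 1) (j + 1)))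

/-- Compatibility of a height function `H` of order `m + 1` with one of order `m`, in the sense of
Robbins and Rumsey: the entries of `K` interlace those of `H`. -/
def Compatible (m : ℕ) (H K : ℕ → ℕ → ℤ) : Prop :=
  ∀ i < m + 1, ∀ j < m + 1, K i j ∈ lowerRange H i j

noncomputable instance (m : ℕ) (H K : ℕ → ℕ → ℤ) : Decidable (Compatible m H K) :=
  inferInstanceAs (Decidable (∀ i < m + 1, ∀ j < m + 1, K i j ∈ lowerRange H i j))

theorem lowerRange_swap (H : ℕ → ℕ → ℤ) (i j : ℕ) :
    lowerRange (Function.swap H) i j = lowerRange H j i := by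
  simp only [lowerRange, Function.swap, min_comm]

theorem upperRange_swap (K : ℕ → ℕ → ℤ) (i j : ℕ) :
    upperRange (Function.swap K) i j = upperRange K j i := by
  simp only [upperRange, Function.swap, max_comm]

section Compatible

variable {m : ℕ} {H K : ℕ → ℕ → ℤ}

theorem compatible_iff_mem_upperRange (hH : HasHeightBoundary (m + 1) H) (hK : IsHeight m K) :
    Compatible m H K ↔ ∀ i < m, ∀ j < m, H (i + 1) (j + 1) ∈ upperRange K i j := by
  simp only [Compatible, lowerRange, upperRange, Finset.mem_Icc]
  constructor
  · intro h i hi j hj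
    have h₀₀ := h i (by omega) j (by omega)
    have h₁₀ := h (i + 1) (by omega) j (by omega)
    have h₀₁ := h i (by omega) (j + 1) (by omega)
    have h₁₁ := h (i + 1) (by omega) (j + 1) (by omega)
    omega
  · intro h i hi j hj
    have hcorner : H i j ≤ K i j := by
      rcases i with _ | i
      · rw [hH.top, hK.boundary.top]
      rcases j with _ | j
      · rw [hH.left, hK.boundary.left]
      have := h i (by omega) j (by omega)
      omega
    have hopposite : H (i + 1) (j + 1) - 1 ≤ K i j := by
      rcases Nat.lt_succ_iff_lt_or_eq.1 hi with hi | rfl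
      · rcases Nat.lt_succ_iff_lt_or_eq.1 hj with hj | rfl
        · have := h i hi j hj
          omega
        · rw [hH.right _ le_rfl, hK.boundary.right _ le_rfl]
          omega
      · rw [hH.bottom le_rfl, hK.boundary.bottom le_rfl]
        omega
    have hdown : K i j ≤ H (i + 1) j := by
      rcases j with _ | j
      · rw [hH.left, hK.boundary.left]
      rcases Nat.lt_succ_iff_lt_or_eq.1 hi with hi | rfl
      · have := h i hi j (by omega)
        omega
      · rw [hH.bottom le_rfl, hK.boundary.bottom le_rfl]
        omega
    have hacross : K i j ≤ H i (j + 1) := by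
      rcases i with _ | i
      · rw [hH.top, hK.boundary.top]
      rcases Nat.lt_succ_iff_lt_or_eq.1 hj with hj | rfl
      · have := h i (by omega) j hj
        omega
      · rw [hH.right _ le_rfl, hK.boundary.right _ le_rfl]
        omega
    omega

theorem down_of_compatible (hK : HasHeightBoundary m K) (h : Compatible m H K) (i j : ℕ) :
    K (i + 1) j = K i j ∨ K (i + 1) j = K i j + 1 := by
  simp only [Compatible, lowerRange, Finset.mem_Icc] at h
  rcases lt_or_ge j m with hj | hj
  · rcases lt_or_ge i m with hi | hi
    · have h₀ := h i (by omega) j (by omega)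
      have h₁ := h (i + 1) (by omega) j (by omega)
      omega
    · rw [hK.bottom hi, hK.bottom (Nat.le_succ_of_le hi)]
      omega
  · rw [hK.right _ hj, hK.right _ hj]
    omega

theorem Compatible.swap (h : Compatible m H K) :
    Compatible m (Function.swap H) (Function.swap K) := by
  intro i hi j hj
  rw [lowerRange_swap]
  exact h j hj i hi

theorem isHeight_of_compatible (hK : HasHeightBoundary m K) (h : Compatible m H K) :
    IsHeight m K :=
  ⟨hK, down_of_compatible hK h, fun i j => down_of_compatible hK.swap h.swap j i⟩

theorem down_of_mem_upperRange (hH : HasHeightBoundary (m + 1) H) (hK : HasHeightBoundary m K)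
    (h : ∀ i < m, ∀ j < m, H (i + 1) (j + 1) ∈ upperRange K i j) (i j : ℕ) :
    H (i + 1) j = H i j ∨ H (i + 1) j = H i j + 1 := by
  simp only [upperRange, Finset.mem_Icc] at h
  rcases j with _ | j
  · rw [hH.left, hH.left]
    omega
  rcases lt_or_ge j m with hj | hj
  · rcases i with _ | i
    · have h₀ := h 0 (by omega) j hj
      rw [hK.top, hK.top] at h₀
      rw [hH.top]
      omega
    · rcases lt_trichotomy (i + 1) m with hi | rfl | hi
      · have h₀ := h i (by omega) j hj
        have h₁ := h (i + 1) hi j hj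
        omega
      · have h₀ := h i (by omega) j hj
        rw [hK.bottom le_rfl, hK.bottom le_rfl] at h₀
        rw [hH.bottom le_rfl]
        omega
      · rw [hH.bottom (by omega), hH.bottom (by omega)]
        omega
  · rw [hH.right _ (by omega), hH.right _ (by omega)]
    omega

theorem isHeight_of_mem_upperRange (hH : HasHeightBoundary (m + 1) H) (hK : HasHeightBoundary m K)
    (h : ∀ i < m, ∀ j < m, H (i + 1) (j + 1) ∈ upperRange K i j) : IsHeight (m + 1) H :=
  ⟨hH, down_of_mem_upperRange hH hK h, fun i j => down_of_mem_upperRange hH.swap hK.swap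
    (fun i hi j hj => by rw [upperRange_swap]; exact h j hj i hi) j i⟩

end Compatible

/-- The function with the boundary values of a height function of order `n` and the values of `p`
at the interior points. -/
def fillBoundary (n : ℕ) (p : ℕ → ℕ → ℤ) (i j : ℕ) : ℤ :=
  if 0 < i ∧ i < n ∧ 0 < j ∧ j < n then p i j else min (min i j) n

theorem hasHeightBoundary_fillBoundary (n : ℕ) (p : ℕ → ℕ → ℤ) :
    HasHeightBoundary n (fillBoundary n p) :=
  fun _ _ h => if_neg (by omega)

theorem HasHeightBoundary.fillBoundary_eq {n : ℕ} {H : ℕ → ℕ → ℤ} (hH : HasHeightBoundary n H)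
    {p : ℕ → ℕ → ℤ} {i j : ℕ} (h : 0 < i → i < n → 0 < j → j < n → p i j = H i j) :
    fillBoundary n p i j = H i j := by
  unfold fillBoundary
  split_ifs with hij
  · exact h hij.1 hij.2.1 hij.2.2.1 hij.2.2.2
  · exact (hH i j (by omega)).symm

theorem HasHeightBoundary.eq_of_mem_lowerRange {m : ℕ} {H : ℕ → ℕ → ℤ}
    (hH : HasHeightBoundary (m + 1) H) {i j : ℕ} (hi : i < m + 1) (hj : j < m + 1)
    (hij : i = 0 ∨ m ≤ i ∨ j = 0 ∨ m ≤ j) {k : ℤ} (hk : k ∈ lowerRange H i j) :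
    k = min (min (i : ℤ) j) m := by
  rw [lowerRange, Finset.mem_Icc] at hk
  rcases hij with rfl | hi | rfl | hj
  · rw [hH.top, hH.top] at hk
    omega
  · rw [hH.bottom (Nat.succ_le_succ hi), hH.bottom (Nat.succ_le_succ hi)] at hk
    omega
  · rw [hH.left, hH.left] at hk
    omega
  · rw [hH.right _ (Nat.succ_le_succ hj), hH.right _ (Nat.succ_le_succ hj)] at hk
    omega

theorem fillBoundary_of_mem_lowerRange {m : ℕ} {H p : ℕ → ℕ → ℤ}
    (hH : HasHeightBoundary (m + 1) H) {i j : ℕ} (hi : i < m + 1) (hj : j < m + 1)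
    (hp : p i j ∈ lowerRange H i j) : fillBoundary m p i j = p i j := by
  unfold fillBoundary
  split_ifs with hij
  · rfl
  · exact (hH.eq_of_mem_lowerRange hi hj (by omega) hp).symm

/-! ### Products over a square -/

section BoxProd

open Finset

variable {M : Type*}

/-- The product of the values of `f` over the square `[0, n) × [0, n)`. -/
def boxProd [CommMonoid M] (n : ℕ) (f : ℕ → ℕ → M) : M :=
  ∏ i ∈ range n, ∏ j ∈ range n, f i j

theorem boxProd_eq_prod_fin [CommMonoid M] (n : ℕ) (f : ℕ → ℕ → M) :
    boxProd n f = ∏ x : Fin n × Fin n, f x.1 x.2 := by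
  rw [boxProd, Fintype.prod_prod_type, ← Fin.prod_univ_eq_prod_range]
  exact prod_congr rfl fun i _ => (Fin.prod_univ_eq_prod_range (f i) n).symm

theorem boxProd_congr [CommMonoid M] {n : ℕ} {f g : ℕ → ℕ → M}
    (h : ∀ i < n, ∀ j < n, f i j = g i j) : boxProd n f = boxProd n g :=
  prod_congr rfl fun i hi => prod_congr rfl fun j hj =>
    h i (mem_range.1 hi) j (mem_range.1 hj)

theorem boxProd_mul [CommMonoid M] (n : ℕ) (f g : ℕ → ℕ → M) :
    boxProd n (fun i j => f i j * g i j) = boxProd n f * boxProd n g := by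
  simp only [boxProd, prod_mul_distrib]

theorem boxProd_swap [CommMonoid M] (n : ℕ) (f : ℕ → ℕ → M) :
    boxProd n (fun i j => f j i) = boxProd n f :=
  prod_comm

theorem boxProd_succ_of_bottom_right [CommMonoid M] {n : ℕ} {f : ℕ → ℕ → M}
    (hbottom : ∀ j < n + 1, f n j = 1) (hright : ∀ i < n, f i n = 1) :
    boxProd (n + 1) f = boxProd n f := by
  rw [boxProd, prod_range_succ, prod_eq_one fun j hj => hbottom j (mem_range.1 hj), mul_one]
  exact prod_congr rfl fun i hi => by
    rw [prod_range_succ, hright i (mem_range.1 hi), mul_one]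

theorem boxProd_succ_of_top_right [CommMonoid M] {n : ℕ} {f : ℕ → ℕ → M}
    (htop : ∀ j < n + 1, f 0 j = 1) (hright : ∀ i < n, f (i + 1) n = 1) :
    boxProd (n + 1) f = boxProd n fun i j => f (i + 1) j := by
  rw [boxProd, prod_range_succ', prod_eq_one fun j hj => htop j (mem_range.1 hj), mul_one]
  exact prod_congr rfl fun i hi => by
    rw [prod_range_succ, hright i (mem_range.1 hi), mul_one]

theorem boxProd_succ_of_left_bottom [CommMonoid M] {n : ℕ} {f : ℕ → ℕ → M}
    (hleft : ∀ i < n + 1, f i 0 = 1) (hbottom : ∀ j < n, f n (j + 1) = 1) :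
    boxProd (n + 1) f = boxProd n fun i j => f i (j + 1) := by
  rw [← boxProd_swap, boxProd_succ_of_top_right hleft hbottom, ← boxProd_swap]

theorem boxProd_succ_of_top_left [CommMonoid M] {n : ℕ} {f : ℕ → ℕ → M}
    (htop : ∀ j < n + 1, f 0 j = 1) (hleft : ∀ i < n, f (i + 1) 0 = 1) :
    boxProd (n + 1) f = boxProd n fun i j => f (i + 1) (j + 1) := by
  rw [boxProd, prod_range_succ', prod_eq_one fun j hj => htop j (mem_range.1 hj), mul_one]
  exact prod_congr rfl fun i hi => by
    rw [prod_range_succ', hleft i (mem_range.1 hi), mul_one]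

end BoxProd

/-! ### Summation over compatible height functions -/

section SumCompatible

open Finset

variable {R : Type*} [CommSemiring R] {m : ℕ}

theorem boxProd_sum (n : ℕ) (s : ℕ → ℕ → Finset ℤ) (f : ℕ → ℕ → ℤ → R) :
    boxProd n (fun i j => ∑ k ∈ s i j, f i j k) =
      ∑ p ∈ Fintype.piFinset fun x : Fin n × Fin n => s x.1 x.2,
        boxProd n fun i j => f i j (extend (Matrix.of p.curry) i j) := by
  simp only [boxProd_eq_prod_fin, prod_univ_sum, extend_val, Matrix.of_apply, Function.curry_apply]

theorem extend_curry_mem {n : ℕ} {s : ℕ → ℕ → Finset ℤ} {p : Fin n × Fin n → ℤ}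
    (hp : p ∈ Fintype.piFinset fun x : Fin n × Fin n => s x.1 x.2) :
    ∀ i < n, ∀ j < n, extend (Matrix.of p.curry) i j ∈ s i j := by
  intro i hi j hj
  rw [extend_of_lt _ hi hj]
  exact Fintype.mem_piFinset.1 hp (⟨i, hi⟩, ⟨j, hj⟩)

theorem sum_compatible_lower (H : Height (m + 1)) (f : ℕ → ℕ → ℤ → R) :
    ∑ K : Height m with Compatible m H.1 K.1, boxProd (m + 1) (fun i j => f i j (K.1 i j)) =
      boxProd (m + 1) fun i j => ∑ k ∈ lowerRange H.1 i j, f i j k := by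
  have hfill {p} (hp : p ∈ Fintype.piFinset
      fun x : Fin (m + 1) × Fin (m + 1) => lowerRange H.1 x.1 x.2) (i) (hi : i < m + 1) (j)
      (hj : j < m + 1) : fillBoundary m (extend (Matrix.of p.curry)) i j =
        extend (Matrix.of p.curry) i j :=
    fillBoundary_of_mem_lowerRange H.2.boundary hi hj (extend_curry_mem hp i hi j hj)
  have hcompat {p} (hp : p ∈ Fintype.piFinset
      fun x : Fin (m + 1) × Fin (m + 1) => lowerRange H.1 x.1 x.2) :
      Compatible m H.1 (fillBoundary m (extend (Matrix.of p.curry))) := fun i hi j hj => by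
    rw [hfill hp i hi j hj]
    exact extend_curry_mem hp i hi j hj
  rw [boxProd_sum]
  refine sum_bij' (fun K _ x => K.1 x.1 x.2)
    (fun p hp => ⟨fillBoundary m (extend (Matrix.of p.curry)),
      isHeight_of_compatible (hasHeightBoundary_fillBoundary _ _) (hcompat hp)⟩) ?_ ?_ ?_ ?_ ?_
  · exact fun K hK => Fintype.mem_piFinset.2 fun x =>
      (mem_filter.1 hK).2 x.1 x.1.2 x.2 x.2.2
  · exact fun p hp => mem_filter.2 ⟨mem_univ _, hcompat hp⟩
  · refine fun K _ => Subtype.ext (funext₂ fun i j => K.2.boundary.fillBoundary_eq ?_)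
    intro _ hi _ hj
    rw [extend_of_lt _ (by omega) (by omega), Matrix.of_apply, Function.curry_apply]
  · refine fun p hp => funext fun x => ?_
    exact (hfill hp _ x.1.2 _ x.2.2).trans (extend_val _ _ _)
  · refine fun K _ => boxProd_congr fun i hi j hj => ?_
    rw [extend_of_lt _ hi hj, Matrix.of_apply, Function.curry_apply]

theorem sum_compatible_upper (K : Height m) (f : ℕ → ℕ → ℤ → R) :
    ∑ H : Height (m + 1) with Compatible m H.1 K.1,
        boxProd m (fun i j => f i j (H.1 (i + 1) (j + 1))) =
      boxProd m fun i j => ∑ k ∈ upperRange K.1 i j, f i j k := by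
  let fill (p : Fin m × Fin m → ℤ) : ℕ → ℕ → ℤ :=
    fillBoundary (m + 1) fun i j => extend (Matrix.of p.curry) (i - 1) (j - 1)
  have hfill (p) {i j} (hi : i < m) (hj : j < m) :
      fill p (i + 1) (j + 1) = extend (Matrix.of p.curry) i j := if_pos (by omega)
  have hmem {p} (hp : p ∈ Fintype.piFinset fun x : Fin m × Fin m => upperRange K.1 x.1 x.2)
      (i) (hi : i < m) (j) (hj : j < m) : fill p (i + 1) (j + 1) ∈ upperRange K.1 i j := by
    rw [hfill p hi hj]
    exact extend_curry_mem hp i hi j hj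
  have hcompat (H : Height (m + 1)) := compatible_iff_mem_upperRange H.2.boundary K.2
  rw [boxProd_sum]
  refine sum_bij' (fun H _ x => H.1 (x.1 + 1) (x.2 + 1))
    (fun p hp => ⟨fill p, isHeight_of_mem_upperRange (hasHeightBoundary_fillBoundary _ _)
      K.2.boundary (hmem hp)⟩) ?_ ?_ ?_ ?_ ?_
  · exact fun H hH => Fintype.mem_piFinset.2 fun x =>
      (hcompat H).1 (mem_filter.1 hH).2 x.1 x.1.2 x.2 x.2.2
  · exact fun p hp => mem_filter.2 ⟨mem_univ _, (hcompat _).2 (hmem hp)⟩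
  · refine fun H _ => Subtype.ext (funext₂ fun i j => ?_)
    refine H.2.boundary.fillBoundary_eq (p := fun i j => extend _ (i - 1) (j - 1)) ?_
    intro hi hi' hj hj'
    rw [extend_of_lt _ (by omega) (by omega), Matrix.of_apply, Function.curry_apply,
      Nat.sub_add_cancel hi, Nat.sub_add_cancel hj]
  · refine fun p hp => funext fun x => ?_
    exact (hfill p x.1.2 x.2.2).trans (extend_val _ _ _)
  · refine fun H _ => boxProd_congr fun i hi j hj => ?_
    rw [extend_of_lt _ hi hj, Matrix.of_apply, Function.curry_apply]

end SumCompatible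

/-! ### Summation by parts -/

section SummationByParts

open Finset

variable {F : Type*} [CommGroupWithZero F]

/-- The cross ratio of four neighbouring values. -/
def cross (X : ℕ → ℕ → F) (i j : ℕ) : F :=
  X i j * X (i + 1) (j + 1) / (X (i + 1) j * X i (j + 1))

/-- The functions on the quadrant that vanish outside the interior of the square
`[0, n] × [0, n]`; they are the differences of functions with the boundary values of a height
function of order `n`. -/
def ZeroBoundary (n : ℕ) (D : ℕ → ℕ → ℤ) : Prop :=
  ∀ i j, i = 0 ∨ n ≤ i ∨ j = 0 ∨ n ≤ j → D i j = 0

theorem HasHeightBoundary.zeroBoundary_sub {n : ℕ} {H K : ℕ → ℕ → ℤ}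
    (hH : HasHeightBoundary n H) (hK : HasHeightBoundary n K) : ZeroBoundary n (H - K) :=
  fun i j h => by rw [Pi.sub_apply, Pi.sub_apply, hH i j h, hK i j h, sub_self]

theorem prod_range_zpow_sub {n : ℕ} {t : ℕ → F} (ht : ∀ j < n + 1, t j ≠ 0) {g : ℕ → ℤ}
    (h₀ : g 0 = 0) (hn : g (n + 1) = 0) :
    ∏ j ∈ range (n + 1), t j ^ (g (j + 1) - g j) =
      ∏ j ∈ range n, (t j / t (j + 1)) ^ g (j + 1) := by
  have h (j) (hj : j ∈ range (n + 1)) : t j ^ (g (j + 1) - g j) = t j ^ g (j + 1) / t j ^ g j :=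
    zpow_sub₀ (ht j (mem_range.1 hj)) _ _
  rw [prod_congr rfl h, prod_div_distrib, prod_range_succ, prod_range_succ' (fun j => t j ^ g j),
    h₀, hn, zpow_zero, zpow_zero, mul_one, mul_one, ← prod_div_distrib]
  exact prod_congr rfl fun j _ => (div_zpow _ _ _).symm

theorem boxProd_zpow_mixedDiff {n : ℕ} {X : ℕ → ℕ → F}
    (hX : ∀ i < n + 1, ∀ j < n + 1, X i j ≠ 0) {D : ℕ → ℕ → ℤ} (hD : ZeroBoundary (n + 1) D) :
    boxProd (n + 1) (fun i j => X i j ^ mixedDiff D i j) =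
      boxProd n fun i j => cross X i j ^ D (i + 1) (j + 1) := by
  have hrow (i) (hi : i ∈ range (n + 1)) : ∏ j ∈ range (n + 1), X i j ^ mixedDiff D i j =
      ∏ j ∈ range n, (X i j / X i (j + 1)) ^ (D (i + 1) (j + 1) - D i (j + 1)) := by
    rw [← prod_range_zpow_sub (g := fun j => D (i + 1) j - D i j) (hX i (mem_range.1 hi))]
    · exact prod_congr rfl fun j _ => by rw [mixedDiff]; congr 1; ring
    · rw [hD _ 0 (by omega), hD _ 0 (by omega), sub_self]
    · rw [hD _ (n + 1) (by omega), hD _ (n + 1) (by omega), sub_self]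
  rw [boxProd, prod_congr rfl hrow, prod_comm, ← boxProd_swap]
  refine prod_congr rfl fun j hj => ?_
  rw [mem_range] at hj
  rw [prod_range_zpow_sub (t := fun i => X i j / X i (j + 1)) (g := fun i => D i (j + 1))]
  · refine prod_congr rfl fun i _ => ?_
    simp only [cross]
    rw [div_div_div_eq, mul_comm (X i (j + 1))]
  · exact fun i hi => div_ne_zero (hX i hi j (by omega)) (hX i hi (j + 1) (by omega))
  · exact hD _ _ (by omega)
  · exact hD _ _ (by omega)

section Pred

variable (X : ℕ → ℕ → F) {n : ℕ} {H : ℕ → ℕ → ℤ}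

theorem boxProd_zpow_mixedDiff_pred_left (hright : ∀ i, mixedDiff H i n = 0) :
    boxProd (n + 1) (fun i j => X i j ^ mixedDiff (fun i j => H (i - 1) j) i j) =
      boxProd n fun i j => X (i + 1) j ^ mixedDiff H i j := by
  have hshift (i j : ℕ) : mixedDiff (fun i j => H (i - 1) j) (i + 1) j = mixedDiff H i j := rfl
  rw [boxProd_succ_of_top_right]
  · simp only [hshift]
  · exact fun j _ => by simp [mixedDiff]
  · exact fun i _ => by rw [hshift, hright, zpow_zero]

theorem boxProd_zpow_mixedDiff_pred_right (hbottom : ∀ j, mixedDiff H n j = 0) :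
    boxProd (n + 1) (fun i j => X i j ^ mixedDiff (fun i j => H i (j - 1)) i j) =
      boxProd n fun i j => X i (j + 1) ^ mixedDiff H i j := by
  have hshift (i j : ℕ) : mixedDiff (fun i j => H i (j - 1)) i (j + 1) = mixedDiff H i j := rfl
  rw [boxProd_succ_of_left_bottom]
  · simp only [hshift]
  · exact fun i _ => by simp [mixedDiff]
  · exact fun j _ => by rw [hshift, hbottom, zpow_zero]

theorem boxProd_zpow_mixedDiff_pred_pred (hbottom : ∀ j, mixedDiff H n j = 0)
    (hright : ∀ i, mixedDiff H i n = 0) :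
    boxProd (n + 2) (fun i j => X i j ^ mixedDiff (fun i j => H (i - 1) (j - 1)) i j) =
      boxProd n fun i j => X (i + 1) (j + 1) ^ mixedDiff H i j := by
  have hshift (i j : ℕ) :
    mixedDiff (fun i j => H (i - 1) (j - 1)) (i + 1) (j + 1) = mixedDiff H i j := rfl
  rw [boxProd_succ_of_top_left, boxProd_succ_of_bottom_right]
  · simp only [hshift]
  · exact fun j _ => by rw [hshift, hbottom, zpow_zero]
  · exact fun i _ => by rw [hshift, hright, zpow_zero]
  · exact fun j _ => by simp [mixedDiff]
  · exact fun i _ => by simp [mixedDiff]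

end Pred

theorem HasHeightBoundary.boxProd_zpow_mixedDiff {m : ℕ} {H H₀ : ℕ → ℕ → ℤ}
    (hH : HasHeightBoundary (m + 1) H) (hH₀ : HasHeightBoundary (m + 1) H₀) {X : ℕ → ℕ → F}
    (hX : ∀ i < m + 1, ∀ j < m + 1, X i j ≠ 0) :
    boxProd (m + 1) (fun i j => X i j ^ mixedDiff H i j) =
      boxProd (m + 1) (fun i j => X i j ^ mixedDiff H₀ i j) *
        boxProd m fun i j => cross X i j ^ (H (i + 1) (j + 1) - H₀ (i + 1) (j + 1)) := by
  have habel := LambdaDet.boxProd_zpow_mixedDiff hX (hH.zeroBoundary_sub hH₀)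
  simp only [Pi.sub_apply] at habel
  rw [← habel, ← boxProd_mul]
  refine boxProd_congr fun i hi j hj => ?_
  rw [← zpow_add₀ (hX i hi j hj), mixedDiff_sub, Pi.sub_apply, Pi.sub_apply, add_sub_cancel]

theorem HasHeightBoundary.boxProd_shift_zpow_neg_mixedDiff {m : ℕ} {K K₀ : ℕ → ℕ → ℤ}
    (hK : HasHeightBoundary m K) (hK₀ : HasHeightBoundary m K₀) {Y : ℕ → ℕ → F}
    (hY : ∀ i < m + 2, ∀ j < m + 2, Y i j ≠ 0) :
    boxProd m (fun i j => Y (i + 1) (j + 1) ^ (-mixedDiff K i j)) =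
      boxProd m (fun i j => Y (i + 1) (j + 1) ^ (-mixedDiff K₀ i j)) *
        boxProd (m + 1) fun i j => cross Y i j ^ (K₀ i j - K i j) := by
  have hbottom (j : ℕ) : mixedDiff (K₀ - K) m j = 0 := by
    rw [mixedDiff_sub, Pi.sub_apply, Pi.sub_apply, hK.mixedDiff_of_le_left le_rfl,
      hK₀.mixedDiff_of_le_left le_rfl, sub_zero]
  have hright (i : ℕ) : mixedDiff (K₀ - K) i m = 0 := by
    rw [mixedDiff_sub, Pi.sub_apply, Pi.sub_apply, hK.mixedDiff_of_le_right _ le_rfl,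
      hK₀.mixedDiff_of_le_right _ le_rfl, sub_zero]
  have habel : boxProd m (fun i j => Y (i + 1) (j + 1) ^ mixedDiff (K₀ - K) i j) =
      boxProd (m + 1) fun i j => cross Y i j ^ (K₀ i j - K i j) :=
    (boxProd_zpow_mixedDiff_pred_pred Y hbottom hright).symm.trans <|
      LambdaDet.boxProd_zpow_mixedDiff hY fun i j h => hK₀.zeroBoundary_sub hK _ _ (by omega)
  rw [← habel, ← boxProd_mul]
  refine boxProd_congr fun i hi j hj => ?_
  rw [← zpow_add₀ (hY _ (by omega) _ (by omega)), mixedDiff_sub, Pi.sub_apply, Pi.sub_apply]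
  congr 1
  ring

end SummationByParts

/-! ### The generating function of compatible pairs -/

section Parameters

variable {F : Type*} [CommGroupWithZero F] {m : ℕ} {H K : ℕ → ℕ → ℤ}

theorem boxProd_zpow_lam (hH : HasHeightBoundary (m + 1) H) (hK : HasHeightBoundary m K)
    (lam : ℤ → F) :
    boxProd (m + 1) (fun i j => lam ((j : ℤ) - i) ^ (1 - H (i + 1) (j + 1) + K i j)) =
      boxProd m fun i j => lam ((j : ℤ) - i) ^ (1 - H (i + 1) (j + 1) + K i j) := by
  refine boxProd_succ_of_bottom_right (fun j hj => ?_) fun i hi => ?_ <;>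
    refine (congrArg _ ?_).trans (zpow_zero _)
  · rw [hH.bottom le_rfl, hK.bottom le_rfl]
    omega
  · rw [hH.right _ le_rfl, hK.right _ le_rfl]
    omega

theorem boxProd_zpow_mu (hH : HasHeightBoundary (m + 1) H) (hK : HasHeightBoundary m K)
    (mu : ℤ → F) :
    boxProd (m + 1) (fun i j => mu ((i : ℤ) + j - m) ^ (H i (j + 1) - K i j)) =
      boxProd m fun i j => mu ((i : ℤ) + 1 + j - m) ^ (H (i + 1) (j + 1) - K (i + 1) j) := by
  rw [boxProd_succ_of_top_right]
  · push_cast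
    rfl
  · intro j _
    rw [hH.top, hK.top, sub_zero, zpow_zero]
  · refine fun i hi => (congrArg _ ?_).trans (zpow_zero _)
    rw [hH.right _ le_rfl, hK.right _ le_rfl]
    omega

end Parameters

section PairSum

variable {F : Type*} [Field F]

/-- The weight of a compatible pair `(H, K)` of height functions of orders `m + 1` and `m`. -/
def pairWeight (m : ℕ) (X W : ℕ → ℕ → F) (lam mu : ℤ → F) (H K : ℕ → ℕ → ℤ) : F :=
  boxProd (m + 1) (fun i j => X i j ^ mixedDiff H i j) *
    boxProd (m + 1) (fun i j => lam ((j : ℤ) - i) ^ (1 - H (i + 1) (j + 1) + K i j) *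
      mu ((i : ℤ) + j - m) ^ (H i (j + 1) - K i j)) *
    boxProd m fun i j => W i j ^ (-mixedDiff K i j)

/-- The generating function of compatible pairs of height functions of orders `m + 1` and `m`. -/
noncomputable def pairSum (m : ℕ) (X W : ℕ → ℕ → F) (lam mu : ℤ → F) : F :=
  ∑ H : Height (m + 1), ∑ K : Height m with Compatible m H.1 K.1,
    pairWeight m X W lam mu H.1 K.1

theorem pairSum_comm (m : ℕ) (X W : ℕ → ℕ → F) (lam mu : ℤ → F) :
    pairSum m X W lam mu = ∑ K : Height m, ∑ H : Height (m + 1) with Compatible m H.1 K.1,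
      pairWeight m X W lam mu H.1 K.1 :=
  Finset.sum_comm' (by simp)

variable {m : ℕ} {X : ℕ → ℕ → F} (lam mu : ℤ → F)

theorem sum_pairWeight_lower (X : ℕ → ℕ → F) {Y : ℕ → ℕ → F}
    (hY : ∀ i < m + 2, ∀ j < m + 2, Y i j ≠ 0) (H : Height (m + 1)) {K₀ : ℕ → ℕ → ℤ}
    (hK₀ : HasHeightBoundary m K₀) :
    ∑ K : Height m with Compatible m H.1 K.1,
        pairWeight m X (fun i j => Y (i + 1) (j + 1)) lam mu H.1 K.1 =
      boxProd (m + 1) (fun i j => X i j ^ mixedDiff H.1 i j) *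
        boxProd m (fun i j => Y (i + 1) (j + 1) ^ (-mixedDiff K₀ i j)) *
        boxProd (m + 1) fun i j => ∑ k ∈ lowerRange H.1 i j,
          lam ((j : ℤ) - i) ^ (1 - H.1 (i + 1) (j + 1) + k) *
            mu ((i : ℤ) + j - m) ^ (H.1 i (j + 1) - k) * cross Y i j ^ (K₀ i j - k) := by
  rw [← sum_compatible_lower, Finset.mul_sum]
  refine Finset.sum_congr rfl fun K _ => ?_
  rw [pairWeight, K.2.boundary.boxProd_shift_zpow_neg_mixedDiff hK₀ hY]
  simp only [boxProd_mul]
  ring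

theorem sum_pairWeight_upper (hX : ∀ i < m + 1, ∀ j < m + 1, X i j ≠ 0) (W : ℕ → ℕ → F)
    (K : Height m) {H₀ : ℕ → ℕ → ℤ} (hH₀ : HasHeightBoundary (m + 1) H₀) :
    ∑ H : Height (m + 1) with Compatible m H.1 K.1, pairWeight m X W lam mu H.1 K.1 =
      boxProd (m + 1) (fun i j => X i j ^ mixedDiff H₀ i j) *
        boxProd m (fun i j => W i j ^ (-mixedDiff K.1 i j)) *
        boxProd m fun i j => ∑ k ∈ upperRange K.1 i j,
          lam ((j : ℤ) - i) ^ (1 - k + K.1 i j) *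
            mu ((i : ℤ) + 1 + j - m) ^ (k - K.1 (i + 1) j) *
              cross X i j ^ (k - H₀ (i + 1) (j + 1)) := by
  rw [← sum_compatible_upper, Finset.mul_sum]
  refine Finset.sum_congr rfl fun H _ => ?_
  rw [pairWeight, H.2.boundary.boxProd_zpow_mixedDiff hH₀ hX]
  simp only [boxProd_mul]
  rw [boxProd_zpow_lam H.2.boundary K.2.boundary, boxProd_zpow_mu H.2.boundary K.2.boundary]
  ring

end PairSum

/-! ### One step of the condensation -/

section Reference

variable {n : ℕ} {K : ℕ → ℕ → ℤ}

/-- The largest height function of order `n - 1` compatible with `K`, for `K` of order `n`. -/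
def lowerReference (n : ℕ) (K : ℕ → ℕ → ℤ) : ℕ → ℕ → ℤ :=
  fillBoundary (n - 1) fun i j => min (K (i + 1) j) (K i (j + 1))

/-- The smallest height function of order `n + 1` compatible with `K`, for `K` of order `n`. -/
def upperReference (n : ℕ) (K : ℕ → ℕ → ℤ) : ℕ → ℕ → ℤ :=
  fillBoundary (n + 1) fun i j => max (K (i - 1) j) (K i (j - 1))

theorem IsHeight.lowerReference_apply (hK : IsHeight (n + 1) K) {i j : ℕ} (hi : i < n + 1)
    (hj : j < n + 1) : lowerReference (n + 1) K i j = min (K (i + 1) j) (K i (j + 1)) := by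
  refine fillBoundary_of_mem_lowerRange hK.boundary hi hj ?_
  have hdown := hK.down i j
  have hacross := hK.across i j
  have hdown' := hK.down i (j + 1)
  have hacross' := hK.across (i + 1) j
  rw [lowerRange, Finset.mem_Icc]
  omega

theorem upperReference_succ_succ {i j : ℕ} (hi : i < n) (hj : j < n) :
    upperReference n K (i + 1) (j + 1) = max (K i (j + 1)) (K (i + 1) j) :=
  if_pos (by omega)

theorem hasHeightBoundary_lowerReference (n : ℕ) (K : ℕ → ℕ → ℤ) :
    HasHeightBoundary n (lowerReference (n + 1) K) :=
  hasHeightBoundary_fillBoundary n _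

theorem hasHeightBoundary_upperReference (n : ℕ) (K : ℕ → ℕ → ℤ) :
    HasHeightBoundary (n + 1) (upperReference n K) :=
  hasHeightBoundary_fillBoundary (n + 1) _

theorem IsHeight.reference_add_reference (hK : IsHeight (n + 1) K) (i j : ℕ) :
    upperReference (n + 1) K i j + lowerReference (n + 1) K (i - 1) (j - 1) =
      K (i - 1) j + K i (j - 1) := by
  have hlower := hasHeightBoundary_lowerReference n K
  have hupper := hasHeightBoundary_upperReference (n + 1) K
  rcases i with _ | i
  · rw [hupper.top, hlower.top, hK.boundary.top, hK.boundary.top]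
  rcases j with _ | j
  · rw [hupper.left, hlower.left, hK.boundary.left, hK.boundary.left]
  simp only [Nat.add_sub_cancel]
  rcases lt_or_ge i (n + 1) with hi | hi
  · rcases lt_or_ge j (n + 1) with hj | hj
    · rw [hK.lowerReference_apply hi hj, upperReference_succ_succ hi hj]
      omega
    · rw [hupper.right _ (by omega), hlower.right _ (by omega), hK.boundary.right _ (by omega),
        hK.boundary.right _ (by omega)]
      omega
  · rw [hupper.bottom (by omega), hlower.bottom (by omega), hK.boundary.bottom (by omega),
      hK.boundary.bottom (by omega)]
    omega

theorem IsHeight.boxProd_zpow_mixedDiff_upperReference {F : Type*} [CommGroupWithZero F]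
    (hK : IsHeight (n + 1) K) {X : ℕ → ℕ → F} (hX : ∀ i < n + 2, ∀ j < n + 2, X i j ≠ 0) :
    boxProd (n + 2) (fun i j => X i j ^ mixedDiff (upperReference (n + 1) K) i j) =
      boxProd (n + 1) (fun i j => (X (i + 1) j * X i (j + 1)) ^ mixedDiff K i j) *
        boxProd n fun i j =>
          X (i + 1) (j + 1) ^ (-mixedDiff (lowerReference (n + 1) K) i j) := by
  have hlower := hasHeightBoundary_lowerReference n K
  have hsplit (i j : ℕ) : mixedDiff (upperReference (n + 1) K) i j =
      mixedDiff (fun i j => K (i - 1) j) i j + mixedDiff (fun i j => K i (j - 1)) i j -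
        mixedDiff (fun i j => lowerReference (n + 1) K (i - 1) (j - 1)) i j := by
    simp only [mixedDiff]
    linarith [hK.reference_add_reference i j, hK.reference_add_reference (i + 1) j,
      hK.reference_add_reference i (j + 1), hK.reference_add_reference (i + 1) (j + 1)]
  have hinv := boxProd_zpow_mixedDiff_pred_pred (fun i j => (X i j)⁻¹)
    (fun j => hlower.mixedDiff_of_le_left le_rfl j) fun i => hlower.mixedDiff_of_le_right i le_rfl
  simp only [inv_zpow'] at hinv
  simp only [mul_zpow, boxProd_mul]
  rw [← boxProd_zpow_mixedDiff_pred_left X fun i => hK.boundary.mixedDiff_of_le_right i le_rfl,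
    ← boxProd_zpow_mixedDiff_pred_right X fun j => hK.boundary.mixedDiff_of_le_left le_rfl j,
    ← hinv, ← boxProd_mul, ← boxProd_mul]
  refine boxProd_congr fun i hi j hj => ?_
  rw [← zpow_add₀ (hX i hi j hj), ← zpow_add₀ (hX i hi j hj), hsplit, sub_eq_add_neg]

end Reference

section LocalIdentity

variable {F : Type*} [Field F]

theorem sum_Icc_self {M : Type*} [AddCommMonoid M] {a b : ℤ} (h : b = a) (f : ℤ → M) :
    ∑ k ∈ Finset.Icc a b, f k = f a := by
  rw [h, Finset.Icc_self, Finset.sum_singleton]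

theorem sum_Icc_succ {M : Type*} [AddCommMonoid M] {a b : ℤ} (h : b = a + 1) (f : ℤ → M) :
    ∑ k ∈ Finset.Icc a b, f k = f a + f (a + 1) := by
  have hpair : Finset.Icc a b = {a, a + 1} := by
    ext k
    rw [Finset.mem_Icc, Finset.mem_insert, Finset.mem_singleton]
    omega
  rw [hpair, Finset.sum_pair (by omega)]

theorem zpow_mul_sum_Icc_eq_sum_Icc {x y r : F} {a b c d : ℤ} (hb : b = a ∨ b = a + 1)
    (hc : c = a ∨ c = a + 1) (hbd : d = b ∨ d = b + 1) (hcd : d = c ∨ d = c + 1)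
    (hxyr : d + a - b - c = -1 → x + y * r ≠ 0) :
    (x + y * r) ^ (d + a - b - c) * ∑ k ∈ Finset.Icc (max a (d - 1)) (min b c),
        x ^ (1 - d + k) * y ^ (c - k) * r ^ (min b c - k) =
      ∑ k ∈ Finset.Icc (max c b) (min (a + 1) d),
        x ^ (1 - k + a) * y ^ (k - b) * r ^ (k - max c b) := by
  -- The common values in the six cases are `x`, `x + y * r`, `y`, `1`, `1` and `1`; the fifth one
  -- comes from `(x + y * r)⁻¹ * (x + y * r)`.
  obtain rfl | rfl := hb <;> obtain rfl | rfl := hc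
  · obtain rfl | rfl := hbd
    · rw [sum_Icc_self (by omega), sum_Icc_self (by omega)]
      simp
    · rw [sum_Icc_self (by omega), sum_Icc_succ (by omega)]
      simp
  · obtain rfl : d = b + 1 := by omega
    rw [sum_Icc_self (by omega), sum_Icc_self (by omega)]
    simp
  · obtain rfl : d = c + 1 := by omega
    rw [sum_Icc_self (by omega), sum_Icc_self (by omega)]
    simp
  · obtain rfl | rfl := hbd
    · have hne := hxyr (by ring)
      have hexp : a + 1 + a - (a + 1) - (a + 1) = -1 := by ring
      rw [sum_Icc_succ (by omega), sum_Icc_self (by omega), hexp, zpow_neg_one,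
        inv_mul_eq_iff_eq_mul₀ hne]
      simp [add_comm]
    · rw [sum_Icc_self (by omega), sum_Icc_self (by omega)]
      simp [show a + 1 + 1 + a - (a + 1) - (a + 1) = 0 by ring]

/-- The matrix obtained from `X` and `W` by one step of the condensation: `X` and `W` hold the
connected minors of orders `k + 1` and `k` of a matrix, and `l + k + 1` is the order of the
matrix. -/
def condense (l : ℕ) (lam mu : ℤ → F) (X W : ℕ → ℕ → F) (i j : ℕ) : F :=
  (mu ((i : ℤ) + j - l) * X i j * X (i + 1) (j + 1) +
    lam ((j : ℤ) - i) * X (i + 1) j * X i (j + 1)) / W i j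

theorem condense_eq_mul_add_mul_cross (l : ℕ) (lam mu : ℤ → F) {X : ℕ → ℕ → F} (W : ℕ → ℕ → F)
    {i j : ℕ} (hleft : X (i + 1) j ≠ 0) (hright : X i (j + 1) ≠ 0) :
    condense l lam mu X W i j = X (i + 1) j * X i (j + 1) / W i j *
      (lam ((j : ℤ) - i) + mu ((i : ℤ) + j - l) * cross X i j) := by
  rw [condense, cross]
  field_simp
  ring

end LocalIdentity

section Condensation

variable {F : Type*} [Field F] {l : ℕ} {lam mu : ℤ → F} {X W : ℕ → ℕ → F}

theorem IsHeight.condense_zpow_mul_sum_lowerRange {K : ℕ → ℕ → ℤ} (hK : IsHeight (l + 1) K)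
    {i j : ℕ} (hi : i < l + 1) (hj : j < l + 1) (hleft : X (i + 1) j ≠ 0)
    (hright : X i (j + 1) ≠ 0)
    (hne : mixedDiff K i j = -1 → condense l lam mu X W i j ≠ 0) :
    condense l lam mu X W i j ^ mixedDiff K i j * ∑ k ∈ lowerRange K i j,
        lam ((j : ℤ) - i) ^ (1 - K (i + 1) (j + 1) + k) *
          mu ((i : ℤ) + j - l) ^ (K i (j + 1) - k) *
            cross X i j ^ (lowerReference (l + 1) K i j - k) =
      (X (i + 1) j * X i (j + 1)) ^ mixedDiff K i j * W i j ^ (-mixedDiff K i j) *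
        ∑ k ∈ upperRange K i j, lam ((j : ℤ) - i) ^ (1 - k + K i j) *
          mu ((i : ℤ) + j - l) ^ (k - K (i + 1) j) *
            cross X i j ^ (k - upperReference (l + 1) K (i + 1) (j + 1)) := by
  have hcondense := condense_eq_mul_add_mul_cross l lam mu W hleft hright
  have h00 := hK.down i j
  have h01 := hK.across i j
  have h10 := hK.across (i + 1) j
  have h11 := hK.down i (j + 1)
  rw [hK.lowerReference_apply hi hj, upperReference_succ_succ hi hj, upperRange, lowerRange,
    ← zpow_mul_sum_Icc_eq_sum_Icc (by omega) (by omega) (by omega) (by omega)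
      fun hm h => hne hm (by rw [hcondense, h, mul_zero]), hcondense, mul_zpow (_ / _), div_zpow,
    zpow_neg, mixedDiff]
  ring

theorem pairSum_condense_of_ne_zero (hX : ∀ i < l + 2, ∀ j < l + 2, X i j ≠ 0)
    (hcondense : ∀ i j, 0 < i → i < l → 0 < j → j < l → condense l lam mu X W i j ≠ 0) :
    pairSum (l + 1) X W lam mu =
      pairSum l (condense l lam mu X W) (fun i j => X (i + 1) (j + 1)) lam mu := by
  rw [pairSum_comm, pairSum]
  refine Finset.sum_congr rfl fun K _ => ?_
  have hlocal : boxProd (l + 1) _ = boxProd (l + 1) _ := boxProd_congr fun i hi j hj =>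
    K.2.condense_zpow_mul_sum_lowerRange (lam := lam) (mu := mu) (W := W) hi hj
      (hX (i + 1) (by omega) j (by omega)) (hX i (by omega) (j + 1) (by omega)) fun hm =>
        have hrow := K.2.row_interior_of_mixedDiff_eq_neg_one hm
        have hcol := K.2.col_interior_of_mixedDiff_eq_neg_one hm
        hcondense i j hrow.1 (by omega) hcol.1 (by omega)
  have hmu (i j : ℕ) : (i : ℤ) + 1 + j - (l + 1 : ℕ) = i + j - l := by
    push_cast
    ring
  rw [sum_pairWeight_upper lam mu hX W K (hasHeightBoundary_upperReference (l + 1) K.1),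
    sum_pairWeight_lower lam mu _ hX K (hasHeightBoundary_lowerReference l K.1),
    K.2.boxProd_zpow_mixedDiff_upperReference hX]
  simp only [boxProd_mul, hmu] at hlocal ⊢
  linear_combination -boxProd l (fun i j =>
    X (i + 1) (j + 1) ^ (-mixedDiff (lowerReference (l + 1) K.1) i j)) * hlocal

end Condensation

/-! ### Degenerate boundary values -/

section Specialization

variable {R : Type*} (L : Type*) {F : Type*} [CommRing R] [Field L] [Algebra R L] [Field F]

/-- The pairs consisting of the image in `L` of an element of `R` and of its value under `φ`. For
`φ` the evaluation of power series at `0` and `L` their field of fractions, this is the graph of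
the evaluation at `0`. -/
def specialization (φ : R →+* F) : Subring (L × F) :=
  ((algebraMap R L).prod φ).range

variable {L} {φ : R →+* F} {x : L} {a : F}

theorem eq_zero_of_mem_specialization [FaithfulSMul R L]
    (h : ((0 : L), a) ∈ specialization L φ) : a = 0 := by
  obtain ⟨r, hr⟩ := h
  obtain ⟨hr₀, rfl⟩ := Prod.mk.inj hr
  rw [(map_eq_zero_iff _ (FaithfulSMul.algebraMap_injective R L)).1 hr₀, map_zero]

theorem inv_mem_specialization [IsLocalHom φ] (h : (x, a) ∈ specialization L φ) (ha : a ≠ 0) :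
    (x⁻¹, a⁻¹) ∈ specialization L φ := by
  obtain ⟨r, hr⟩ := h
  obtain ⟨rfl, rfl⟩ := Prod.mk.inj hr
  obtain ⟨u, rfl⟩ := isUnit_of_map_unit φ r ha.isUnit
  refine ⟨(u⁻¹ : Rˣ), Prod.ext ?_ ?_⟩
  · exact map_units_inv (algebraMap R L) u
  · exact map_units_inv φ u

theorem zpow_mem_specialization [IsLocalHom φ] (h : (x, a) ∈ specialization L φ) {e : ℤ}
    (he : e = -1 ∨ e = 0 ∨ e = 1) (ha : e = -1 → a ≠ 0) :
    (x ^ e, a ^ e) ∈ specialization L φ := by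
  obtain rfl | rfl | rfl := he
  · rw [zpow_neg_one, zpow_neg_one]
    exact inv_mem_specialization h (ha rfl)
  · rw [zpow_zero, zpow_zero]
    exact one_mem (specialization L φ)
  · rwa [zpow_one, zpow_one]

theorem sum_mem_specialization {ι : Type*} {s : Finset ι} {f : ι → L} {g : ι → F}
    (h : ∀ i ∈ s, (f i, g i) ∈ specialization L φ) :
    (∑ i ∈ s, f i, ∑ i ∈ s, g i) ∈ specialization L φ := by
  rw [prod_mk_sum]
  exact sum_mem h

theorem prod_mem_specialization {ι : Type*} {s : Finset ι} {f : ι → L} {g : ι → F}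
    (h : ∀ i ∈ s, (f i, g i) ∈ specialization L φ) :
    (∏ i ∈ s, f i, ∏ i ∈ s, g i) ∈ specialization L φ := by
  rw [prod_mk_prod]
  exact prod_mem h

theorem boxProd_mem_specialization {n : ℕ} {f : ℕ → ℕ → L} {g : ℕ → ℕ → F}
    (h : ∀ i < n, ∀ j < n, (f i j, g i j) ∈ specialization L φ) :
    (boxProd n f, boxProd n g) ∈ specialization L φ :=
  prod_mem_specialization fun i hi => prod_mem_specialization fun j hj =>
    h i (Finset.mem_range.1 hi) j (Finset.mem_range.1 hj)

variable [IsLocalHom φ] {m : ℕ} {X' W' : ℕ → ℕ → L} {X W : ℕ → ℕ → F} {lam' mu' : ℤ → L}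
  {lam mu : ℤ → F}

theorem pairSum_mem_specialization
    (hX : ∀ i < m + 1, ∀ j < m + 1, (X' i j, X i j) ∈ specialization L φ)
    (hX₀ : ∀ i j, 0 < i → i < m → 0 < j → j < m → X i j ≠ 0)
    (hW : ∀ i < m, ∀ j < m, (W' i j, W i j) ∈ specialization L φ)
    (hW₀ : ∀ i < m, ∀ j < m, W i j ≠ 0)
    (hlam : ∀ a, (lam' a, lam a) ∈ specialization L φ)
    (hmu : ∀ a, (mu' a, mu a) ∈ specialization L φ) :
    (pairSum m X' W' lam' mu', pairSum m X W lam mu) ∈ specialization L φ := by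
  refine sum_mem_specialization fun H _ => sum_mem_specialization fun K hK =>
    mul_mem (S := Subring (L × F)) (mul_mem (S := Subring (L × F))
      (boxProd_mem_specialization fun i hi j hj => ?_)
      (boxProd_mem_specialization fun i hi j hj => ?_))
      (boxProd_mem_specialization fun i hi j hj => ?_)
  · refine zpow_mem_specialization (hX i hi j hj) (H.2.mixedDiff_mem i j) fun h => ?_
    have hrow := H.2.row_interior_of_mixedDiff_eq_neg_one h
    have hcol := H.2.col_interior_of_mixedDiff_eq_neg_one h
    exact hX₀ i j hrow.1 (by omega) hcol.1 (by omega)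
  · have hrange := (Finset.mem_filter.1 hK).2 i hi j hj
    have hacross := H.2.across i j
    have hdown := H.2.down i (j + 1)
    rw [lowerRange, Finset.mem_Icc] at hrange
    exact mul_mem (S := Subring (L × F))
      (zpow_mem_specialization (hlam _) (by omega) (by omega))
      (zpow_mem_specialization (hmu _) (by omega) (by omega))
  · have hmem := K.2.mixedDiff_mem i j
    exact zpow_mem_specialization (hW i hi j hj) (by omega) fun _ => hW₀ i hi j hj

theorem condense_mem_specialization (l : ℕ) (hX : ∀ i j, (X' i j, X i j) ∈ specialization L φ)
    (hlam : ∀ a, (lam' a, lam a) ∈ specialization L φ)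
    (hmu : ∀ a, (mu' a, mu a) ∈ specialization L φ) {i j : ℕ}
    (hW : (W' i j, W i j) ∈ specialization L φ) (hW₀ : W i j ≠ 0) :
    (condense l lam' mu' X' W' i j, condense l lam mu X W i j) ∈ specialization L φ := by
  rw [condense, condense, div_eq_mul_inv, div_eq_mul_inv]
  exact mul_mem (add_mem (mul_mem (mul_mem (hmu _) (hX _ _)) (hX _ _))
    (mul_mem (mul_mem (hlam _) (hX _ _)) (hX _ _))) (inv_mem_specialization hW hW₀)

end Specialization

section Deformation

open PowerSeries

variable {F : Type*} [Field F]

theorem isLocalHom_constantCoeff : IsLocalHom (constantCoeff (R := F)) :=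
  ⟨fun _ => isUnit_iff_constantCoeff.2⟩

theorem C_add_X_ne_zero (a : F) : (C a + X : F⟦X⟧) ≠ 0 := fun h => by
  simpa [coeff_C] using congrArg (coeff 1) h

/- Boundary values may vanish. The previous identity applies after `X i j` is replaced by
`X i j + t` in the field of fractions of power series in `t`, and both sides are regular at
`t = 0`. -/
theorem pairSum_condense {l : ℕ} {lam mu : ℤ → F} {X W : ℕ → ℕ → F}
    (hX : ∀ i j, 0 < i → i < l + 1 → 0 < j → j < l + 1 → X i j ≠ 0)
    (hW : ∀ i < l + 1, ∀ j < l + 1, W i j ≠ 0)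
    (hcondense : ∀ i j, 0 < i → i < l → 0 < j → j < l → condense l lam mu X W i j ≠ 0) :
    pairSum (l + 1) X W lam mu =
      pairSum l (condense l lam mu X W) (fun i j => X (i + 1) (j + 1)) lam mu := by
  have := isLocalHom_constantCoeff (F := F)
  let S := specialization (FractionRing F⟦X⟧) (constantCoeff (R := F))
  let ι := algebraMap F⟦X⟧ (FractionRing F⟦X⟧)
  have hconst (a : F) : (ι (C a), a) ∈ S := ⟨C a, by simp [ι]⟩
  have hX' (i j : ℕ) : (ι (C (X i j) + PowerSeries.X), X i j) ∈ S :=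
    ⟨C (X i j) + PowerSeries.X, by simp [ι]⟩
  have hcondense' (i) (hi : i < l + 1) (j) (hj : j < l + 1) :=
    condense_mem_specialization (W' := fun i j => ι (C (W i j))) l hX' (fun a => hconst (lam a))
      (fun a => hconst (mu a)) (hconst (W i j)) (hW i hi j hj)
  have hleft := pairSum_mem_specialization (m := l + 1) (fun i _ j _ => hX' i j) hX
    (fun i _ j _ => hconst (W i j)) hW (fun a => hconst (lam a)) fun a => hconst (mu a)
  have hright := pairSum_mem_specialization hcondense' hcondense
    (fun i _ j _ => hX' (i + 1) (j + 1))
    (fun i hi j hj => hX _ _ (by omega) (by omega) (by omega) (by omega))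
    (fun a => hconst (lam a)) fun a => hconst (mu a)
  have hdeformed := pairSum_condense_of_ne_zero (l := l)
    (X := fun i j => ι (C (X i j) + PowerSeries.X)) (W := fun i j => ι (C (W i j)))
    (lam := fun a => ι (C (lam a))) (mu := fun a => ι (C (mu a)))
    (fun i _ j _ h => C_add_X_ne_zero _ ((map_eq_zero_iff ι (IsFractionRing.injective _ _)).1 h))
    fun i j hi hi' hj hj' h => hcondense i j hi hi' hj hj' <|
      eq_zero_of_mem_specialization (h ▸ hcondense' i (by omega) j (by omega))
  have hdiff := sub_mem hleft hright
  rw [hdeformed, Prod.mk_sub_mk, sub_self] at hdiff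
  exact sub_eq_zero.1 (eq_zero_of_mem_specialization hdiff)

end Deformation

/-! ### Connected minors -/

section Blocks

variable {F : Type*}

/-- The connected `k × k` submatrix of an infinite matrix with upper left corner `(i, j)`. -/
def block (a : ℕ → ℕ → F) (k i j : ℕ) : Matrix (Fin k) (Fin k) F :=
  Matrix.of fun p q => a (i + p) (j + q)

section Minors

variable (a : ℕ → ℕ → F) (k i j : ℕ)

theorem minorFF_block : minorFF (block a (k + 1) i j) = block a k (i + 1) (j + 1) := by
  ext p q
  simp [minorFF, block, add_assoc, add_comm 1]

theorem minorLL_block : minorLL (block a (k + 1) i j) = block a k i j := by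
  ext p q
  simp [minorLL, block]

theorem minorFL_block : minorFL (block a (k + 1) i j) = block a k (i + 1) j := by
  ext p q
  simp [minorFL, block, add_assoc, add_comm 1]

theorem minorLF_block : minorLF (block a (k + 1) i j) = block a k i (j + 1) := by
  ext p q
  simp [minorLF, block, add_assoc, add_comm 1]

theorem interior_block : interior (block a (k + 2) i j) = block a k (i + 1) (j + 1) := by
  ext p q
  simp [interior, block, add_assoc, add_comm 1]

end Minors

theorem shift_zero (f : ℤ → F) : shift 0 f = f := by
  ext
  simp [shift]

theorem shift_shift (k l : ℤ) (f : ℤ → F) : shift k (shift l f) = shift (k + l) f := by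
  ext
  simp [shift, add_assoc]

/-- The value of `Φ` on a connected submatrix of order `k`, with the shifted parameters with which
this submatrix is met in the recursion for a matrix of order `l + k`. -/
def onBlock {α : Sort*} (Φ : ∀ k, Matrix (Fin k) (Fin k) F → (ℤ → F) → (ℤ → F) → α)
    (a : ℕ → ℕ → F) (lam mu : ℤ → F) (l k i j : ℕ) : α :=
  Φ k (block a k i j) (shift ((j : ℤ) - i) lam) (shift ((i : ℤ) + j - l) mu)

section OnBlock

variable {α : Sort*} (Φ : ∀ k, Matrix (Fin k) (Fin k) F → (ℤ → F) → (ℤ → F) → α)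
  (a : ℕ → ℕ → F) (lam mu : ℤ → F) (l k i j : ℕ)

theorem onBlock_minorFF :
    Φ k (minorFF (block a (k + 1) i j)) (shift ((j : ℤ) - i) lam)
        (shift 1 (shift ((i : ℤ) + j - l) mu)) =
      onBlock Φ a lam mu (l + 1) k (i + 1) (j + 1) := by
  rw [onBlock, minorFF_block, shift_shift]
  push_cast
  ring_nf

theorem onBlock_minorLL :
    Φ k (minorLL (block a (k + 1) i j)) (shift ((j : ℤ) - i) lam)
        (shift (-1) (shift ((i : ℤ) + j - l) mu)) =
      onBlock Φ a lam mu (l + 1) k i j := by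
  rw [onBlock, minorLL_block, shift_shift]
  push_cast
  ring_nf

theorem onBlock_minorFL :
    Φ k (minorFL (block a (k + 1) i j)) (shift (-1) (shift ((j : ℤ) - i) lam))
        (shift ((i : ℤ) + j - l) mu) =
      onBlock Φ a lam mu (l + 1) k (i + 1) j := by
  rw [onBlock, minorFL_block, shift_shift]
  push_cast
  ring_nf

theorem onBlock_minorLF :
    Φ k (minorLF (block a (k + 1) i j)) (shift 1 (shift ((j : ℤ) - i) lam))
        (shift ((i : ℤ) + j - l) mu) =
      onBlock Φ a lam mu (l + 1) k i (j + 1) := by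
  rw [onBlock, minorLF_block, shift_shift]
  push_cast
  ring_nf

theorem onBlock_interior :
    Φ k (interior (block a (k + 2) i j)) (shift ((j : ℤ) - i) lam)
        (shift ((i : ℤ) + j - l) mu) =
      onBlock Φ a lam mu (l + 2) k (i + 1) (j + 1) := by
  rw [onBlock, interior_block]
  push_cast
  ring_nf

theorem onBlock_extend {R : Type*} [Zero R]
    (Φ : ∀ k, Matrix (Fin k) (Fin k) R → (ℤ → R) → (ℤ → R) → α) {n : ℕ}
    (A : Matrix (Fin n) (Fin n) R) (lam mu : ℤ → R) :
    onBlock Φ (extend A) lam mu 0 n 0 0 = Φ n A lam mu := by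
  have hblock : block (extend A) n 0 0 = A := by
    ext i j
    simp [block, extend_val]
  simp [onBlock, hblock, shift_zero]

end OnBlock

end Blocks

section Condensable

variable {F : Type*} [Field F] {a : ℕ → ℕ → F} {lam mu : ℤ → F}

theorem onBlock_lambdaDet_add_two (a : ℕ → ℕ → F) (lam mu : ℤ → F) (l k : ℕ) :
    onBlock lambdaDet a lam mu l (k + 2) =
      condense l lam mu (onBlock lambdaDet a lam mu (l + 1) (k + 1))
        fun i j => onBlock lambdaDet a lam mu (l + 2) k (i + 1) (j + 1) := by
  ext i j
  rw [onBlock, lambdaDet, onBlock_minorFF lambdaDet, onBlock_minorLL lambdaDet,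
    onBlock_minorFL lambdaDet, onBlock_minorLF lambdaDet, onBlock_interior lambdaDet, condense,
    shift, shift, zero_add, zero_add]
  ring

theorem onBlock_condensable_add_two {l k i j : ℕ} :
    onBlock Condensable a lam mu l (k + 2) i j ↔
      onBlock Condensable a lam mu (l + 1) (k + 1) (i + 1) (j + 1) ∧
      onBlock Condensable a lam mu (l + 1) (k + 1) i j ∧
      onBlock Condensable a lam mu (l + 1) (k + 1) (i + 1) j ∧
      onBlock Condensable a lam mu (l + 1) (k + 1) i (j + 1) ∧
      onBlock Condensable a lam mu (l + 2) k (i + 1) (j + 1) ∧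
      onBlock lambdaDet a lam mu (l + 2) k (i + 1) (j + 1) ≠ 0 := by
  rw [onBlock, Condensable, onBlock_minorFF Condensable, onBlock_minorLL Condensable,
    onBlock_minorFL Condensable, onBlock_minorLF Condensable, onBlock_interior Condensable,
    onBlock_interior lambdaDet]

theorem onBlock_condensable_of_top {n : ℕ} (h : onBlock Condensable a lam mu 0 n 0 0)
    {l k i j : ℕ} (hn : l + k = n) (hi : i ≤ l) (hj : j ≤ l) :
    onBlock Condensable a lam mu l k i j := by
  induction l generalizing k i j with
  | zero =>
    obtain rfl : i = 0 := by omega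
    obtain rfl : j = 0 := by omega
    obtain rfl : k = n := by omega
    exact h
  | succ l ih =>
    rcases k with _ | k
    · trivial
    have hlarger (i j) (hi : i ≤ l) (hj : j ≤ l) :=
      onBlock_condensable_add_two.1 (ih (k := k + 2) (by omega) hi hj)
    rcases hi.lt_or_eq with hi | rfl <;> rcases hj.lt_or_eq with hj | rfl
    · exact (hlarger i j (by omega) (by omega)).2.1
    · exact (hlarger i l (by omega) le_rfl).2.2.2.1
    · exact (hlarger l j le_rfl (by omega)).2.2.1
    · exact (hlarger l l le_rfl le_rfl).1

theorem onBlock_lambdaDet_ne_zero {n : ℕ} (h : onBlock Condensable a lam mu 0 n 0 0)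
    {l k i j : ℕ} (hn : l + k = n) (hi : 0 < i) (hi' : i < l) (hj : 0 < j) (hj' : j < l) :
    onBlock lambdaDet a lam mu l k i j ≠ 0 := by
  obtain ⟨l, rfl⟩ : ∃ l', l = l' + 2 := ⟨l - 2, by omega⟩
  obtain ⟨i, rfl⟩ : ∃ i', i = i' + 1 := ⟨i - 1, by omega⟩
  obtain ⟨j, rfl⟩ : ∃ j', j = j' + 1 := ⟨j - 1, by omega⟩
  have hlarger := onBlock_condensable_of_top h (l := l) (k := k + 2) (i := i) (j := j)
  exact (onBlock_condensable_add_two.1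
    (hlarger (by omega) (by omega) (by omega))).2.2.2.2.2

theorem pairSum_onBlock_lambdaDet {l k : ℕ}
    (h : onBlock Condensable a lam mu 0 (l + k + 1) 0 0) :
    pairSum (l + k) (onBlock lambdaDet a lam mu (l + k) 1) (fun _ _ => 1) lam mu =
      pairSum l (onBlock lambdaDet a lam mu l (k + 1))
        (fun i j => onBlock lambdaDet a lam mu (l + 1) k (i + 1) (j + 1)) lam mu := by
  induction k generalizing l with
  | zero => rfl
  | succ k ih =>
    have hl : l + (k + 1) = l + 1 + k := by omega
    rw [hl] at h ⊢
    rw [ih h, onBlock_lambdaDet_add_two]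
    refine pairSum_condense (fun i j hi hi' hj hj' => ?_) (fun i hi j hj => ?_)
      fun i j hi hi' hj hj' => ?_
    · exact onBlock_lambdaDet_ne_zero h (by omega) hi hi' hj hj'
    · exact onBlock_lambdaDet_ne_zero h (by omega) (by omega) (by omega) (by omega) (by omega)
    · rw [← onBlock_lambdaDet_add_two]
      exact onBlock_lambdaDet_ne_zero h (by omega) hi hi' hj hj'

end Condensable

/-! ### The expansion over alternating sign matrices -/

section Expansion

variable {F : Type*} [Field F]

theorem pairSum_zero (X W : ℕ → ℕ → F) (lam mu : ℤ → F) : pairSum 0 X W lam mu = X 0 0 := by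
  let := uniqueHeight (n := 0) (by omega)
  let := uniqueHeight (n := 0 + 1) (by omega)
  have h₀ : (default : Height 0).1 = fun i j : ℕ => min (min (i : ℤ) j) 0 := rfl
  have h₁ : (default : Height (0 + 1)).1 = fun i j : ℕ => min (min (i : ℤ) j) 1 := rfl
  have hcompatible : Compatible 0 (default : Height (0 + 1)).1 (default : Height 0).1 := by
    intro i hi j hj
    obtain rfl : i = 0 := by omega
    obtain rfl : j = 0 := by omega
    simp [lowerRange, h₀, h₁]
  rw [pairSum, Fintype.sum_unique, Finset.sum_filter, Fintype.sum_unique, if_pos hcompatible]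
  simp [pairWeight, boxProd, mixedDiff, h₀, h₁]

theorem heightEquiv_config_right {n : ℕ} (H : Height n) (i : Fin n) (k : Fin (n + 1)) :
    (heightEquiv n H).config.right i k = decide (H.1 (i + 1) k - H.1 i k = 0) := by
  rw [← H.2.boundary.rowSum_diffMatrix i (Nat.lt_succ_iff.1 k.2)]
  rfl

theorem heightEquiv_config_up {n : ℕ} (H : Height n) (k : Fin (n + 1)) (j : Fin n) :
    (heightEquiv n H).config.up k j = decide (H.1 k (j + 1) - H.1 k j = 0) := by
  rw [← H.2.boundary.colSum_diffMatrix j (Nat.lt_succ_iff.1 k.2)]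
  rfl

/- The two values in `lowerRange H i j` at a `c₂` vertex give rise to the two terms of its
weight. -/
theorem weight_heightEquiv {n : ℕ} (A : Matrix (Fin n) (Fin n) F) (H : Height n) (lam mu : ℤ → F)
    (i j : Fin n) :
    weight A (heightEquiv n H) lam mu i j = A i j ^ mixedDiff H.1 i j *
      ∑ k ∈ lowerRange H.1 i j, lam ((j : ℤ) - i) ^ (1 - H.1 (i + 1) (j + 1) + k) *
        mu ((i : ℤ) + j + 1 - n) ^ (H.1 i (j + 1) - k) := by
  rw [weight]
  congr 1
  have hwest : (heightEquiv n H).config.right i j.castSucc =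
      decide (H.1 (i + 1) j - H.1 i j = 0) := heightEquiv_config_right H i j.castSucc
  have heast : (heightEquiv n H).config.right i j.succ =
      decide (H.1 (i + 1) (j + 1) - H.1 i (j + 1) = 0) := heightEquiv_config_right H i j.succ
  have hnorth : (heightEquiv n H).config.up i.castSucc j =
      decide (H.1 i (j + 1) - H.1 i j = 0) := heightEquiv_config_up H i.castSucc j
  rw [SixVertexDWBC.vertex, hwest, heast, hnorth, lowerRange]
  clear hwest heast hnorth
  have h00 := H.2.down i j
  have h01 := H.2.across i j
  have h10 := H.2.across (i + 1) j
  have h11 := H.2.down i (j + 1)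
  generalize H.1 i j = a at *
  generalize H.1 (i + 1) j = b at *
  generalize H.1 i (j + 1) = c at *
  generalize H.1 (i + 1) (j + 1) = d at *
  obtain rfl | rfl := h00
  · obtain rfl | rfl := h01
    · obtain rfl | rfl := h10 <;> rw [sum_Icc_self (by omega)] <;> simp
    · obtain rfl : d = b + 1 := by omega
      rw [sum_Icc_self (by omega)]
      simp
  · obtain rfl | rfl := h01
    · obtain rfl : d = c + 1 := by omega
      rw [sum_Icc_self (by omega)]
      simp
    · obtain rfl | rfl := h10
      · rw [sum_Icc_succ (by omega)]
        simp [add_comm]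
      · rw [sum_Icc_self (by omega)]
        simp

theorem sum_weight_eq_pairSum {m : ℕ} (A : Matrix (Fin (m + 1)) (Fin (m + 1)) F)
    (lam mu : ℤ → F) :
    ∑ B : ASM (m + 1), ∏ i, ∏ j, weight A B lam mu i j =
      pairSum m (extend A) (fun _ _ => 1) lam mu := by
  rw [pairSum, ← (heightEquiv (m + 1)).sum_comp]
  refine Finset.sum_congr rfl fun H _ => ?_
  have hindex (i j : ℕ) : (i : ℤ) + j + 1 - (m + 1 : ℕ) = i + j - m := by
    push_cast
    ring
  have hpair (K : ℕ → ℕ → ℤ) : pairWeight m (extend A) (fun _ _ => 1) lam mu H.1 K =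
      boxProd (m + 1) (fun i j => extend A i j ^ mixedDiff H.1 i j) *
        boxProd (m + 1) (fun i j => lam ((j : ℤ) - i) ^ (1 - H.1 (i + 1) (j + 1) + K i j) *
          mu ((i : ℤ) + j - m) ^ (H.1 i (j + 1) - K i j)) := by
    simp [pairWeight, boxProd]
  simp only [hpair]
  rw [← Finset.mul_sum, sum_compatible_lower H fun i j k =>
    lam ((j : ℤ) - i) ^ (1 - H.1 (i + 1) (j + 1) + k) *
      mu ((i : ℤ) + j - m) ^ (H.1 i (j + 1) - k), ← boxProd_mul, boxProd_eq_prod_fin,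
    Fintype.prod_prod_type]
  exact Finset.prod_congr rfl fun i _ => Finset.prod_congr rfl fun j _ => by
    rw [weight_heightEquiv, extend_val, hindex]

theorem lambdaDet_eq_pairSum {m : ℕ} {A : Matrix (Fin (m + 1)) (Fin (m + 1)) F} {lam mu : ℤ → F}
    (hA : Condensable (m + 1) A lam mu) :
    lambdaDet (m + 1) A lam mu = pairSum m (extend A) (fun _ _ => 1) lam mu := by
  have hpair := pairSum_onBlock_lambdaDet (a := extend A) (lam := lam) (mu := mu) (l := 0) (k := m)
    (by rwa [zero_add, onBlock_extend])
  rw [pairSum_zero, onBlock_extend, zero_add] at hpair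
  exact hpair.symm

theorem lambdaDet_eq_sum_weight {n : ℕ} {A : Matrix (Fin n) (Fin n) F} {lam mu : ℤ → F}
    (hA : Condensable n A lam mu) :
    lambdaDet n A lam mu = ∑ B : ASM n, ∏ i, ∏ j, weight A B lam mu i j := by
  rcases n with _ | m
  · let := uniqueHeight (n := 0) (by omega)
    let := (heightEquiv 0).symm.unique
    rw [Fintype.sum_unique, Fin.prod_univ_zero, lambdaDet]
  · rw [sum_weight_eq_pairSum, lambdaDet_eq_pairSum hA]

end Expansion

/-! ### Matrices of indeterminates -/

section Generic

variable {F K : Type*} [Field F] [Field K] [Algebra F K] {n : ℕ}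

/-- The identity matrix as an alternating sign matrix. -/
def diagonalASM (n : ℕ) : ASM n :=
  heightEquiv n ⟨_, isHeight_min n⟩

/-- The factor of the local weight that depends only on the parameters: the weight for the matrix
with all entries `1`. -/
def paramWeight (B : ASM n) (lam mu : ℤ → F) (i j : Fin n) : F :=
  weight (Matrix.of fun _ _ => 1) B lam mu i j

theorem weight_eq_zpow_mul_paramWeight (A : Matrix (Fin n) (Fin n) F) (B : ASM n) (lam mu : ℤ → F)
    (i j : Fin n) : weight A B lam mu i j = A i j ^ B.1 i j * paramWeight B lam mu i j := by
  simp [paramWeight, weight]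

theorem paramWeight_algebraMap (B : ASM n) (lam mu : ℤ → F) (i j : Fin n) :
    paramWeight B (fun a => algebraMap F K (lam a)) (fun a => algebraMap F K (mu a)) i j =
      algebraMap F K (paramWeight B lam mu i j) := by
  simp only [paramWeight, weight, Matrix.of_apply, one_zpow, one_mul]
  cases B.config.vertex i j <;> simp

theorem paramWeight_diagonalASM (lam mu : ℤ → F) (i j : Fin n) :
    paramWeight (diagonalASM n) lam mu i j = if j < i then mu ((i : ℤ) + j + 1 - n) else 1 := by
  rw [paramWeight, diagonalASM, weight_heightEquiv, Matrix.of_apply, one_zpow, one_mul, lowerRange]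
  have hi := i.2
  have hj := j.2
  have hlam : 1 - min (min (((i + 1 : ℕ) : ℤ)) (j + 1 : ℕ)) n + min (i : ℤ) j = 0 := by omega
  have hmu : min (min (i : ℤ) (j + 1 : ℕ)) n - min (i : ℤ) j = if j < i then 1 else 0 := by
    split_ifs <;> omega
  dsimp only
  rw [min_eq_left (b := (n : ℤ)) (by omega), sum_Icc_self (by omega), max_eq_left (by omega), hlam,
    hmu]
  split_ifs <;> simp

/-- The exponents of the monomial of an alternating sign matrix, multiplied by all the
indeterminates. -/
noncomputable def asmExponent (B : ASM n) : Fin n × Fin n →₀ ℕ :=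
  Finsupp.equivFunOnFinite.symm fun x => (1 + B.1 x.1 x.2).toNat

theorem asmExponent_apply (B : ASM n) (i j : Fin n) : (asmExponent B (i, j) : ℤ) = 1 + B.1 i j := by
  refine Int.toNat_of_nonneg ?_
  rcases B.2.entry i j with h | h | h <;> simp [h]

theorem asmExponent_injective (n : ℕ) : Function.Injective (asmExponent (n := n)) := by
  intro B B' h
  refine Subtype.ext (Matrix.ext fun i j => ?_)
  have hB := asmExponent_apply B i j
  rw [h, asmExponent_apply] at hB
  omega

/-- The sum of the weights of all alternating sign matrices, multiplied by all matrix entries, as a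
polynomial in these entries. -/
noncomputable def numerator (n : ℕ) (lam mu : ℤ → F) : MvPolynomial (Fin n × Fin n) F :=
  ∑ B : ASM n, MvPolynomial.monomial (asmExponent B) (∏ i, ∏ j, paramWeight B lam mu i j)

theorem coeff_numerator (lam mu : ℤ → F) (B : ASM n) :
    (numerator n lam mu).coeff (asmExponent B) = ∏ i, ∏ j, paramWeight B lam mu i j := by
  classical
  rw [numerator, MvPolynomial.coeff_sum]
  simp only [MvPolynomial.coeff_monomial, (asmExponent_injective n).eq_iff]
  rw [Finset.sum_ite_eq' Finset.univ, if_pos (Finset.mem_univ _)]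

theorem numerator_ne_zero (lam : ℤ → F) {mu : ℤ → F} (hmu : ∀ a : ℤ, |a| ≤ (n : ℤ) - 2 → mu a ≠ 0) :
    numerator n lam mu ≠ 0 := by
  have hcoeff : (numerator n lam mu).coeff (asmExponent (diagonalASM n)) ≠ 0 := by
    rw [coeff_numerator]
    refine Finset.prod_ne_zero_iff.2 fun i _ => Finset.prod_ne_zero_iff.2 fun j _ => ?_
    rw [paramWeight_diagonalASM]
    split_ifs with hij
    · exact hmu _ (abs_le.2 (by omega))
    · exact one_ne_zero
  intro h
  exact hcoeff (by rw [h, MvPolynomial.coeff_zero])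

theorem prod_mul_sum_weight {A : Matrix (Fin n) (Fin n) K} (hA : ∀ i j, A i j ≠ 0)
    (lam mu : ℤ → F) :
    (∏ i, ∏ j, A i j) * ∑ B : ASM n, ∏ i, ∏ j,
        weight A B (fun a => algebraMap F K (lam a)) (fun a => algebraMap F K (mu a)) i j =
      MvPolynomial.aeval (fun x : Fin n × Fin n => A x.1 x.2) (numerator n lam mu) := by
  rw [numerator, map_sum, Finset.mul_sum]
  refine Finset.sum_congr rfl fun B _ => ?_
  rw [MvPolynomial.aeval_monomial, Finsupp.prod_fintype _ _ (by simp), Fintype.prod_prod_type,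
    map_prod]
  simp only [map_prod, ← Finset.prod_mul_distrib]
  refine Finset.prod_congr rfl fun i _ => Finset.prod_congr rfl fun j _ => ?_
  have hpow : A i j ^ asmExponent B (i, j) = A i j * A i j ^ B.1 i j := by
    rw [← zpow_one_add₀ (hA i j), ← asmExponent_apply, zpow_natCast]
  rw [weight_eq_zpow_mul_paramWeight, paramWeight_algebraMap, hpow]
  ring

theorem sum_weight_ne_zero {A : Matrix (Fin n) (Fin n) K}
    (hA : AlgebraicIndependent F fun x : Fin n × Fin n => A x.1 x.2) (lam : ℤ → F) {mu : ℤ → F}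
    (hmu : ∀ a : ℤ, |a| ≤ (n : ℤ) - 2 → mu a ≠ 0) :
    ∑ B : ASM n, ∏ i, ∏ j,
      weight A B (fun a => algebraMap F K (lam a)) (fun a => algebraMap F K (mu a)) i j ≠ 0 := by
  refine right_ne_zero_of_mul (a := ∏ i, ∏ j, A i j) ?_
  rw [prod_mul_sum_weight fun i j => hA.ne_zero (i, j)]
  exact (map_ne_zero_iff _ hA).2 (numerator_ne_zero lam hmu)

theorem algebraicIndependent_submatrix {m : ℕ} {A : Matrix (Fin n) (Fin n) K}
    (hA : AlgebraicIndependent F fun x : Fin n × Fin n => A x.1 x.2) {f g : Fin m → Fin n}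
    (hf : Function.Injective f) (hg : Function.Injective g) :
    AlgebraicIndependent F fun x : Fin m × Fin m => A.submatrix f g x.1 x.2 :=
  hA.comp (Prod.map f g) (hf.prodMap hg)

theorem condensable_of_algebraicIndependent (n : ℕ) {A : Matrix (Fin n) (Fin n) K}
    (hA : AlgebraicIndependent F fun x : Fin n × Fin n => A x.1 x.2) (lam : ℤ → F) {mu : ℤ → F}
    (hmu : ∀ a : ℤ, |a| ≤ (n : ℤ) - 4 → mu a ≠ 0) :
    Condensable n A (fun a => algebraMap F K (lam a)) (fun a => algebraMap F K (mu a)) := by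
  induction n using Nat.twoStepInduction generalizing lam mu with
  | zero => trivial
  | one => trivial
  | more n ih ih' =>
    have hsucc := Fin.succ_injective (n + 1)
    have hcastSucc := Fin.castSucc_injective (n + 1)
    have hinner : Function.Injective fun i : Fin n => i.castSucc.succ :=
      (Fin.succ_injective _).comp (Fin.castSucc_injective _)
    have hshift (c : ℤ) (hc : |c| ≤ 1) (a : ℤ) (ha : |a| ≤ ((n + 1 : ℕ) : ℤ) - 4) :
        shift c mu a ≠ 0 :=
      hmu _ (by have := abs_add_le a c; push_cast at *; omega)
    have hmu' (a : ℤ) (ha : |a| ≤ ((n + 1 : ℕ) : ℤ) - 4) : mu a ≠ 0 :=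
      hmu a (by push_cast at *; omega)
    have hindep := algebraicIndependent_submatrix hA hinner hinner
    have hinterior : Condensable n (interior A) _ _ :=
      ih hindep lam fun a ha => hmu a (by push_cast; omega)
    refine ⟨ih' (algebraicIndependent_submatrix hA hsucc hsucc) lam (hshift 1 (by simp)),
      ih' (algebraicIndependent_submatrix hA hcastSucc hcastSucc) lam (hshift (-1) (by simp)),
      ih' (algebraicIndependent_submatrix hA hsucc hcastSucc) (shift (-1) lam) hmu',
      ih' (algebraicIndependent_submatrix hA hcastSucc hsucc) (shift 1 lam) hmu', hinterior, ?_⟩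
    rw [lambdaDet_eq_sum_weight hinterior]
    exact sum_weight_ne_zero hindep lam fun a ha => hmu a (by push_cast; omega)

theorem algebraicIndependent_genericMatrix (F : Type*) [Field F] (n : ℕ) :
    AlgebraicIndependent F fun x : Fin n × Fin n => genericMatrix F n x.1 x.2 :=
  (MvPolynomial.algebraicIndependent_X (Fin n × Fin n) F).map'
    (f := IsScalarTower.toAlgHom F (MvPolynomial (Fin n × Fin n) F) (GenericField F n))
    (IsFractionRing.injective _ _)

end Generic

end LambdaDet

open LambdaDet in
theorem mainTheorem1_general {F K : Type*} [Field F] [Field K] [Algebra F K] (n : ℕ)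
    (lam mu : ℤ → F) :
    (∀ A : Matrix (Fin n) (Fin n) F, Condensable n A lam mu →
      lambdaDet n A lam mu = ∑ B : ASM n, ∏ i, ∏ j, weight A B lam mu i j) ∧
    ∀ A : Matrix (Fin n) (Fin n) K, AlgebraicIndependent F (fun x : Fin n × Fin n => A x.1 x.2) →
      (∀ a : ℤ, |a| ≤ (n : ℤ) - 4 → mu a ≠ 0) →
      Condensable n A (fun a => algebraMap F K (lam a)) (fun a => algebraMap F K (mu a)) ∧
      lambdaDet n A (fun a => algebraMap F K (lam a)) (fun a => algebraMap F K (mu a)) =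
        ∑ B : ASM n, ∏ i, ∏ j,
          weight A B (fun a => algebraMap F K (lam a)) (fun a => algebraMap F K (mu a)) i j := by
  refine ⟨fun A hA => lambdaDet_eq_sum_weight hA, fun A hA hmu => ?_⟩
  have hcondensable := condensable_of_algebraicIndependent n hA lam hmu
  exact ⟨hcondensable, lambdaDet_eq_sum_weight hcondensable⟩

/-- The first part is the formula for all matrices and parameters for which the recursive
definition makes sense; the second part says that, for nonvanishing parameters, the definition
makes sense for a matrix of indeterminates, where the formula is thus an identity of rational
functions. -/
theorem mainTheorem1 {F : Type*} [Field F] (n : ℕ) (lam mu : ℤ → F) :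
    (∀ A : Matrix (Fin n) (Fin n) F, LambdaDet.Condensable n A lam mu →
      LambdaDet.lambdaDet n A lam mu =
        ∑ B : LambdaDet.ASM n, ∏ i, ∏ j, LambdaDet.weight A B lam mu i j) ∧
    ((∀ a : ℤ, |a| ≤ (n : ℤ) - 2 → lam a ≠ 0 ∧ mu a ≠ 0) →
      LambdaDet.Condensable n (LambdaDet.genericMatrix F n)
        (LambdaDet.constParam n lam) (LambdaDet.constParam n mu) ∧
      LambdaDet.lambdaDet n (LambdaDet.genericMatrix F n)
          (LambdaDet.constParam n lam) (LambdaDet.constParam n mu) =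
        ∑ B : LambdaDet.ASM n, ∏ i, ∏ j,
          LambdaDet.weight (LambdaDet.genericMatrix F n) B
            (LambdaDet.constParam n lam) (LambdaDet.constParam n mu) i j) := by
  have hgeneral := mainTheorem1_general (K := LambdaDet.GenericField F n) n lam mu
  exact ⟨hgeneral.1, fun h => hgeneral.2 _ (LambdaDet.algebraicIndependent_genericMatrix F n)
    fun a ha => (h a (by omega)).2⟩
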